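/- Fix an integer $b\ge 1$. The edges of the complete graph $K_n$ receive independent uniform $[0,1]$ costs, known to both players. In each round Maker takes an edge that has been neither taken nor deleted, and then Breaker deletes $b$ edges not taken by Maker (all of the remaining ones if there are fewer than $b$). Maker has to take $n-1$ edges in this way that form a spanning tree of $K_n$; the cost of the tree is the sum of the costs of its edges. Let $\theta^*\approx 0.2938$ be the unique positive solution of $(1+\theta)\log(1+\theta)-\theta\log\theta=\log 2$. Let $\mu_b$ be the least $\mu\ge 1$ with $\frac{\log(b+1)-1}{b+1}\le \mu-1-\log\mu$; that is, for $b\ge 2$, $\mu_b$ is the unique solution $\mu>1$ of $\frac{\log(b+1)-1}{b+1}=\mu-1-\log\mu$, and $\mu_1=1$. Theorem. There is a sequence $\varepsilon_n\to 0$ (depending on $b$) such that, with probability tending to $1$ as $n\to\infty$, Maker has a strategy that, however Breaker plays, builds a spanning tree of cost at most $$4\mu_b\Big(\frac{b}{\theta^*}+b+1+\varepsilon_n\Big).$$ -/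

import Mathlib

open Filter Topology MeasureTheory

/-! ### The two constants -/

/-- The function whose value at `θ*` is `log 2`. -/
noncomputable def thetaFun (x : ℝ) : ℝ :=
  (1 + x) * Real.log (1 + x) - x * Real.log x

theorem existsUnique_theta :
    ∃! x : ℝ, 0 < x ∧ (1 + x) * Real.log (1 + x) - x * Real.log x = Real.log 2 := by
  have hc : Continuous thetaFun := by
    unfold thetaFun
    exact (Real.continuous_mul_log.comp (continuous_const.add continuous_id)).sub
      Real.continuous_mul_log
  have hm : StrictMonoOn thetaFun (Set.Ici 0) := by
    apply strictMonoOn_of_deriv_pos (convex_Ici 0) hc.continuousOn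
    intro x hx
    rw [interior_Ici, Set.mem_Ioi] at hx
    have h1 : HasDerivAt (fun y : ℝ => 1 + y) 1 x := (hasDerivAt_id x).const_add 1
    have h2 := (h1.mul (h1.log (by linarith))).sub
      ((hasDerivAt_id x).mul ((hasDerivAt_id x).log hx.ne'))
    have h3 : deriv thetaFun x = _ := h2.deriv
    rw [h3]
    have h4 : Real.log x < Real.log (1 + x) := Real.log_lt_log hx (by linarith)
    have h5 : (1 + x) ≠ 0 := by linarith
    have h6 : x ≠ 0 := hx.ne'
    simp only [id]
    field_simp
    linarith
  have h0 : thetaFun 0 = 0 := by simp [thetaFun]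
  have hl : 0 < Real.log 2 := Real.log_pos (by norm_num)
  have h1 : thetaFun 1 = 2 * Real.log 2 := by
    simp only [thetaFun, Real.log_one]; norm_num
  obtain ⟨x, hx, hxe⟩ : Real.log 2 ∈ thetaFun '' Set.Icc 0 1 :=
    intermediate_value_Icc (by norm_num) hc.continuousOn ⟨by rw [h0]; exact hl.le, by
      rw [h1]; linarith⟩
  refine ⟨x, ⟨lt_of_le_of_ne hx.1 ?_, hxe⟩, ?_⟩
  · rintro rfl
    rw [h0] at hxe
    linarith
  · rintro y ⟨hy, hye⟩
    exact hm.injOn hy.le hx.1 (Eq.trans hye hxe.symm)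

/-- `θ* ≈ 0.2938` is the unique positive solution of
`(1 + θ) log (1 + θ) - θ log θ = log 2`. -/
noncomputable def thetaStar : ℝ := existsUnique_theta.choose

theorem thetaStar_pos : 0 < thetaStar := existsUnique_theta.choose_spec.1.1

theorem thetaStar_eq :
    (1 + thetaStar) * Real.log (1 + thetaStar) - thetaStar * Real.log thetaStar = Real.log 2 :=
  existsUnique_theta.choose_spec.1.2

theorem mu_continuousOn : ContinuousOn (fun x : ℝ => x - 1 - Real.log x) (Set.Ici 1) := by
  refine (continuousOn_id.sub continuousOn_const).sub (Real.continuousOn_log.mono ?_)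
  intro x hx
  have : (1 : ℝ) ≤ x := hx
  simp only [Set.mem_compl_iff, Set.mem_singleton_iff]
  linarith

theorem mu_exists_isLeast (b : ℕ) :
    ∃ m : ℝ, IsLeast {x : ℝ | 1 ≤ x ∧
      (Real.log (b + 1) - 1) / (b + 1) ≤ x - 1 - Real.log x} m := by
  set a : ℝ := (Real.log (b + 1) - 1) / (b + 1)
  have hcl : IsClosed {x : ℝ | 1 ≤ x ∧ a ≤ x - 1 - Real.log x} :=
    mu_continuousOn.preimage_isClosed_of_isClosed isClosed_Ici isClosed_Ici
  have hbd : BddBelow {x : ℝ | 1 ≤ x ∧ a ≤ x - 1 - Real.log x} := ⟨1, fun x hx => hx.1⟩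
  refine ⟨_, hcl.csInf_mem ⟨(|a| + 2) ^ 2, ?_, ?_⟩ hbd, fun x hx => csInf_le hbd hx⟩
  · nlinarith [abs_nonneg a]
  · have h1 := Real.log_le_sub_one_of_pos (show (0 : ℝ) < |a| + 2 by positivity)
    rw [Real.log_pow]
    push_cast
    nlinarith [abs_nonneg a, le_abs_self a]

/-- `μ_b`: the least `μ ≥ 1` with `(log (b + 1) - 1) / (b + 1) ≤ μ - 1 - log μ`.
For `2 ≤ b` it is the unique `μ > 1` with equality (see `muB_unique`); for `b = 1` the left side is
negative, the equation has no solution, and `μ_1 = 1`. -/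
noncomputable def muB (b : ℕ) : ℝ := (mu_exists_isLeast b).choose

theorem muB_isLeast (b : ℕ) :
    IsLeast {x : ℝ | 1 ≤ x ∧ (Real.log (b + 1) - 1) / (b + 1) ≤ x - 1 - Real.log x} (muB b) :=
  (mu_exists_isLeast b).choose_spec

theorem muB_unique (b : ℕ) (hb : 2 ≤ b) (x : ℝ) :
    (1 < x ∧ (Real.log (b + 1) - 1) / (b + 1) = x - 1 - Real.log x) ↔ x = muB b := by
  obtain ⟨⟨h1, h2⟩, h3⟩ := muB_isLeast b
  have hb' : (2 : ℝ) ≤ b := by exact_mod_cast hb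
  have ha : 0 < (Real.log (b + 1) - 1) / (b + 1) := by
    apply div_pos _ (by linarith)
    have h4 : (1 : ℝ) < Real.log (b + 1) := by
      rw [Real.lt_log_iff_exp_lt (by linarith)]
      linarith [Real.exp_one_lt_d9]
    linarith
  have hgt : 1 < muB b := by
    refine lt_of_le_of_ne h1 fun h => ?_
    rw [← h, Real.log_one] at h2
    linarith
  have heq : (Real.log (b + 1) - 1) / (b + 1) = muB b - 1 - Real.log (muB b) := by
    obtain ⟨y, hy, hye⟩ : (Real.log (b + 1) - 1) / (b + 1) ∈
        (fun x : ℝ => x - 1 - Real.log x) '' Set.Icc 1 (muB b) :=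
      intermediate_value_Icc h1 (mu_continuousOn.mono Set.Icc_subset_Ici_self)
        ⟨by simpa using ha.le, h2⟩
    have : y = muB b := le_antisymm hy.2 (h3 ⟨hy.1, hye.ge⟩)
    rw [← this]
    exact hye.symm
  refine ⟨?_, ?_⟩
  · rintro ⟨hx, hxe⟩
    refine le_antisymm (not_lt.1 fun hlt => ?_) (h3 ⟨hx.le, hxe.le⟩)
    have h5 := Real.log_lt_sub_one_of_pos (show 0 < x / muB b by positivity)
      (by rw [ne_eq, div_eq_one_iff_eq (by positivity)]; exact hlt.ne')
    rw [Real.log_div (by positivity) (by positivity)] at h5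
    have h6 : x / muB b - 1 ≤ x - muB b := by
      rw [div_sub_one (by positivity), div_le_iff₀ (by positivity)]
      nlinarith
    linarith
  · rintro rfl
    exact ⟨hgt, heq⟩

/-! ### The game -/

/-- The edges of the complete graph on `n` vertices. -/
abbrev Edge (n : ℕ) : Type := (⊤ : SimpleGraph (Fin n)).edgeSet

/-- The graph on all `n` vertices whose edges are those in `M`. -/
def graphOf {n : ℕ} (M : Finset (Edge n)) : SimpleGraph (Fin n) :=
  SimpleGraph.fromEdgeSet ((fun e : Edge n => (e : Sym2 (Fin n))) '' (M : Set (Edge n)))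

/-- `MakerCanBuild b c K k M B`: from the position in which Maker owns `M`, the edges in `B` are
deleted, Maker is to move and `k` rounds are left, Maker can guarantee that her edges at the end
form a spanning tree of total cost at most `K`.
In a round, Maker first takes an edge that is neither taken nor deleted, then Breaker, who knows
all the costs and the position, deletes at most `b` edges not taken by Maker. (A deletion never
helps Maker, so letting Breaker delete fewer than `b` edges only matters when fewer are left.) -/
def MakerCanBuild {n : ℕ} (b : ℕ) (c : Edge n → ℝ) (K : ℝ) :
    ℕ → Finset (Edge n) → Finset (Edge n) → Prop
  | 0, M, _ => (graphOf M).IsTree ∧ ∑ e ∈ M, c e ≤ K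
  | k + 1, M, B => ∃ e : Edge n, e ∉ M ∧ e ∉ B ∧
      ∀ D : Finset (Edge n), D.card ≤ b → Disjoint D (insert e M) →
        MakerCanBuild b c K k (insert e M) (B ∪ D)

/-- Maker can build a spanning tree of cost at most `K` in the game of bias `b` on the complete
graph with edge costs `c`: all `n - 1` edges she takes are edges of her tree. -/
def MakerWins {n : ℕ} (b : ℕ) (c : Edge n → ℝ) (K : ℝ) : Prop :=
  MakerCanBuild b c K (n - 1) ∅ ∅

/-- The joint law of independent uniform `[0,1]` costs of the edges of the complete graph. -/
noncomputable def costLaw (n : ℕ) : Measure (Edge n → ℝ) :=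
  Measure.pi fun _ => (volume : Measure ℝ).restrict (Set.Icc 0 1)

/-! The proof gives the bound `16 * b + 4` with no error term; it suffices because `1 ≤ muB b` and
`thetaStar ≤ 1 / 3`.

Round the costs up: an edge of cost `c` has level `⌈n * c⌉`. Summing by levels, the cost of a tree
is at most `1 / n` times the sum over `i` of the number of components, minus one, formed by its
edges of level at most `i`. So Maker needs few components at every level. Give each edge to one of
its ends, so that every vertex owns about `n / 2` edges. A component at level `i` is weighed by an
exponential that grows as its vertices lose owned edges of level at most `i`; the potential adds
these weights over components and levels.

Maker looks at the useful live edge whose owner carries the largest share of the potential from the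
level of that edge on, and takes the cheapest live edge leaving the component of the owner at that
level. Merging replaces two weights by at most their average, so the potential falls by at least a
quarter of what any edge still useful afterwards carries (`exists_maker_move`). The `b` deletions
that follow raise it by no more than this (`potential_union_le`), so it never exceeds its initial
value (`Controlled.step`).

At the end every edge outside `D` lies inside a component at its own level (`spans_low`). Small
vertex sets span few cheap edges, so small components have weight at least `1` and the potential
counts them. There are at most `a` large components, and expansion leaves only one at level `Y`,
since Breaker deletes at most `b * n` edges. The initial weights are exponential moments of binomial
variables, and Chebyshev and Markov bound their sum with high probability. -/

/-! ### Components of Maker's graph and sums over them. -/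

section Components
open scoped Classical

variable {n : ℕ}

/-- The vertices in the component of `v` in the graph with edge set `M`. -/
noncomputable def cls (M : Finset (Edge n)) (v : Fin n) : Finset (Fin n) :=
  Finset.univ.filter fun u => (graphOf M).Reachable v u

/-- The edge `e` has exactly one end in `S`. -/
def Crosses (S : Finset (Fin n)) (e : Edge n) : Prop :=
  ∃ u w, (e : Sym2 (Fin n)) = s(u, w) ∧ u ∈ S ∧ w ∉ S

/-- Both ends of `e` lie in the same component of the graph with edge set `M`. -/
def Spans (M : Finset (Edge n)) (e : Edge n) : Prop :=
  ∀ u w, (e : Sym2 (Fin n)) = s(u, w) → (graphOf M).Reachable u w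

/-- The edges of `M` of level at most `i`. -/
def low (l : Edge n → ℕ) (i : ℕ) (M : Finset (Edge n)) : Finset (Edge n) :=
  M.filter fun e => l e ≤ i

theorem edge_ends (e : Edge n) : ∃ u w, (e : Sym2 (Fin n)) = s(u, w) ∧ u ≠ w := by
  obtain ⟨e, he⟩ := e
  induction e with
  | _ u w => exact ⟨u, w, rfl, by simpa using he⟩

theorem graphOf_adj {M : Finset (Edge n)} {u w : Fin n} :
    (graphOf M).Adj u w ↔ ∃ e ∈ M, (e : Sym2 (Fin n)) = s(u, w) := by
  unfold graphOf
  rw [SimpleGraph.fromEdgeSet_adj]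
  constructor
  · rintro ⟨⟨e, he, h⟩, -⟩
    exact ⟨e, he, h⟩
  · rintro ⟨e, he, h⟩
    refine ⟨⟨e, he, h⟩, ?_⟩
    have := e.2
    rw [h] at this
    simpa using this

theorem graphOf_mono {M N : Finset (Edge n)} (h : M ⊆ N) : graphOf M ≤ graphOf N := by
  intro u w
  rw [graphOf_adj, graphOf_adj]
  rintro ⟨e, he, h'⟩
  exact ⟨e, h he, h'⟩

theorem mem_cls {M : Finset (Edge n)} {u v : Fin n} :
    u ∈ cls M v ↔ (graphOf M).Reachable v u := by simp [cls]

theorem self_mem_cls (M : Finset (Edge n)) (v : Fin n) : v ∈ cls M v :=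
  mem_cls.2 (SimpleGraph.Reachable.refl _)

theorem cls_nonempty (M : Finset (Edge n)) (v : Fin n) : (cls M v).Nonempty := ⟨v, self_mem_cls M v⟩

theorem cls_card_pos (M : Finset (Edge n)) (v : Fin n) : 0 < (cls M v).card :=
  (cls_nonempty M v).card_pos

theorem cls_eq_of_mem {M : Finset (Edge n)} {u v : Fin n} (h : u ∈ cls M v) :
    cls M u = cls M v := by
  ext x
  rw [mem_cls] at h
  rw [mem_cls, mem_cls]
  exact ⟨fun h' => h.trans h', fun h' => h.symm.trans h'⟩

theorem cls_mono {M N : Finset (Edge n)} (h : M ⊆ N) (v : Fin n) : cls M v ⊆ cls N v := by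
  intro x
  rw [mem_cls, mem_cls]
  exact fun h' => h'.mono (graphOf_mono h)

theorem low_subset (l : Edge n → ℕ) (i : ℕ) (M : Finset (Edge n)) : low l i M ⊆ M :=
  Finset.filter_subset _ _

theorem low_mono {l : Edge n → ℕ} {i j : ℕ} (h : i ≤ j) (M : Finset (Edge n)) :
    low l i M ⊆ low l j M := by
  intro e
  simp only [low, Finset.mem_filter]
  exact fun h' => ⟨h'.1, h'.2.trans h⟩

theorem low_mono_right {l : Edge n → ℕ} {i : ℕ} {M N : Finset (Edge n)} (h : M ⊆ N) :
    low l i M ⊆ low l i N := Finset.filter_subset_filter _ h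

theorem spans_mono {M N : Finset (Edge n)} (h : M ⊆ N) {e : Edge n} (he : Spans M e) :
    Spans N e := fun u w huw => (he u w huw).mono (graphOf_mono h)

theorem spans_of_reachable {M : Finset (Edge n)} {e : Edge n} {u w : Fin n}
    (h : (e : Sym2 (Fin n)) = s(u, w)) (hr : (graphOf M).Reachable u w) : Spans M e := by
  intro x y hxy
  rw [h, Sym2.eq_iff] at hxy
  rcases hxy with ⟨rfl, rfl⟩ | ⟨rfl, rfl⟩
  · exact hr
  · exact hr.symm

theorem spans_of_mem {M : Finset (Edge n)} {e : Edge n} (he : e ∈ M) : Spans M e :=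
  fun _ _ h => (graphOf_adj.2 ⟨e, he, h⟩).reachable

theorem not_crosses_of_spans {M : Finset (Edge n)} {e : Edge n} (he : Spans M e) (v : Fin n) :
    ¬ Crosses (cls M v) e := by
  rintro ⟨u, w, h, hu, hw⟩
  rw [mem_cls] at hu hw
  exact hw (hu.trans (he u w h))

theorem mem_iff_of_reachable {M : Finset (Edge n)} {A : Finset (Fin n)}
    (h : ∀ e ∈ M, ¬ Crosses A e) {u w : Fin n} (hr : (graphOf M).Reachable u w) :
    u ∈ A ↔ w ∈ A := by
  obtain ⟨p⟩ := hr
  induction p with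
  | nil => rfl
  | @cons a b c hab p ih =>
    rw [← ih]
    obtain ⟨e, he, hs⟩ := graphOf_adj.1 hab
    constructor
    · intro ha
      by_contra hb
      exact h e he ⟨a, b, hs, ha, hb⟩
    · intro hb
      by_contra ha
      exact h e he ⟨b, a, by rw [hs, Sym2.eq_swap], hb, ha⟩

theorem reachable_insert {M : Finset (Edge n)} {f : Edge n} {u w : Fin n}
    (hf : (f : Sym2 (Fin n)) = s(u, w)) {x y : Fin n} :
    (graphOf (insert f M)).Reachable x y ↔ (graphOf M).Reachable x y ∨
      ((graphOf M).Reachable x u ∧ (graphOf M).Reachable w y) ∨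
      ((graphOf M).Reachable x w ∧ (graphOf M).Reachable u y) := by
  constructor
  · rintro ⟨p⟩
    induction p with
    | nil => exact Or.inl (SimpleGraph.Reachable.refl _)
    | @cons a b c hab p ih =>
      obtain ⟨e, he, hs⟩ := graphOf_adj.1 hab
      rcases Finset.mem_insert.1 he with rfl | he
      · rw [hf, Sym2.eq_iff] at hs
        have hr : ∀ z, (graphOf M).Reachable z z := fun z => SimpleGraph.Reachable.refl _
        rcases hs with ⟨rfl, rfl⟩ | ⟨rfl, rfl⟩
        · rcases ih with h | ⟨-, h⟩ | ⟨-, h⟩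
          · exact Or.inr (Or.inl ⟨hr _, h⟩)
          · exact Or.inr (Or.inl ⟨hr _, h⟩)
          · exact Or.inl h
        · rcases ih with h | ⟨-, h⟩ | ⟨-, h⟩
          · exact Or.inr (Or.inr ⟨hr _, h⟩)
          · exact Or.inl h
          · exact Or.inr (Or.inr ⟨hr _, h⟩)
      · have hab' : (graphOf M).Reachable a b := (graphOf_adj.2 ⟨e, he, hs⟩).reachable
        rcases ih with h | ⟨h, h'⟩ | ⟨h, h'⟩
        · exact Or.inl (hab'.trans h)
        · exact Or.inr (Or.inl ⟨hab'.trans h, h'⟩)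
        · exact Or.inr (Or.inr ⟨hab'.trans h, h'⟩)
  · have hm : graphOf M ≤ graphOf (insert f M) := graphOf_mono (Finset.subset_insert _ _)
    have huw : (graphOf (insert f M)).Reachable u w :=
      (graphOf_adj.2 ⟨f, Finset.mem_insert_self _ _, hf⟩).reachable
    rintro (h | ⟨h, h'⟩ | ⟨h, h'⟩)
    · exact h.mono hm
    · exact ((h.mono hm).trans huw).trans (h'.mono hm)
    · exact ((h.mono hm).trans huw.symm).trans (h'.mono hm)

theorem cls_insert_of_mem {M : Finset (Edge n)} {f : Edge n} {u w : Fin n}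
    (hf : (f : Sym2 (Fin n)) = s(u, w)) {v : Fin n} (hv : v ∈ cls M u ∪ cls M w) :
    cls (insert f M) v = cls M u ∪ cls M w := by
  ext x
  simp only [Finset.mem_union, mem_cls] at hv ⊢
  rw [reachable_insert hf]
  constructor
  · rintro (h | ⟨-, h⟩ | ⟨-, h⟩)
    · exact hv.imp (fun h' => h'.trans h) (fun h' => h'.trans h)
    · exact Or.inr h
    · exact Or.inl h
  · rintro (h | h)
    · exact hv.elim (fun h' => Or.inl (h'.symm.trans h)) fun h' => Or.inr (Or.inr ⟨h'.symm, h⟩)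
    · exact hv.elim (fun h' => Or.inr (Or.inl ⟨h'.symm, h⟩)) fun h' => Or.inl (h'.symm.trans h)

theorem cls_insert_of_notMem {M : Finset (Edge n)} {f : Edge n} {u w : Fin n}
    (hf : (f : Sym2 (Fin n)) = s(u, w)) {v : Fin n} (hv : v ∉ cls M u ∪ cls M w) :
    cls (insert f M) v = cls M v := by
  ext x
  simp only [Finset.mem_union, mem_cls, not_or] at hv ⊢
  rw [reachable_insert hf]
  constructor
  · rintro (h | ⟨h, -⟩ | ⟨h, -⟩)
    · exact h
    · exact absurd h.symm hv.1
    · exact absurd h.symm hv.2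
  · exact Or.inl

theorem cls_disjoint {M : Finset (Edge n)} {u w : Fin n} (h : ¬ (graphOf M).Reachable u w) :
    Disjoint (cls M u) (cls M w) := by
  rw [Finset.disjoint_left]
  intro x hx hx'
  rw [mem_cls] at hx hx'
  exact h (hx.trans hx'.symm)

/-- The sum of `F` over the components, spread evenly over their vertices. -/
noncomputable def total (M : Finset (Edge n)) (F : Finset (Fin n) → ℝ) : ℝ :=
  ∑ v, F (cls M v) / (cls M v).card

theorem sum_cls (M : Finset (Edge n)) (F : Finset (Fin n) → ℝ) (u : Fin n) :
    ∑ v ∈ cls M u, F (cls M v) / (cls M v).card = F (cls M u) := by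
  rw [Finset.sum_congr rfl fun v hv => by rw [cls_eq_of_mem hv], Finset.sum_const, nsmul_eq_mul]
  have := cls_card_pos M u
  field_simp

theorem total_insert {M : Finset (Edge n)} {f : Edge n} {u w : Fin n}
    (hf : (f : Sym2 (Fin n)) = s(u, w)) (h : ¬ (graphOf M).Reachable u w)
    (F : Finset (Fin n) → ℝ) :
    total (insert f M) F = total M F - F (cls M u) - F (cls M w) + F (cls M u ∪ cls M w) := by
  have hd := cls_disjoint h
  have h1 : total M F = ∑ v ∈ cls M u ∪ cls M w, F (cls M v) / (cls M v).card
      + ∑ v ∈ (cls M u ∪ cls M w)ᶜ, F (cls M v) / (cls M v).card :=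
    (Finset.sum_add_sum_compl _ _).symm
  have h2 : total (insert f M) F = F (cls M u ∪ cls M w)
      + ∑ v ∈ (cls M u ∪ cls M w)ᶜ, F (cls M v) / (cls M v).card := by
    unfold total
    rw [← Finset.sum_add_sum_compl (cls M u ∪ cls M w)]
    congr 1
    · have := sum_cls (insert f M) F u
      rwa [cls_insert_of_mem hf (Finset.mem_union_left _ (self_mem_cls M u))] at this
    · refine Finset.sum_congr rfl fun v hv => ?_
      rw [cls_insert_of_notMem hf (Finset.mem_compl.1 hv)]
  rw [Finset.sum_union hd, sum_cls, sum_cls] at h1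
  linarith

theorem total_empty (F : Finset (Fin n) → ℝ) : total ∅ F = ∑ v, F {v} := by
  have h : ∀ v : Fin n, cls ∅ v = {v} := by
    intro v
    ext x
    rw [mem_cls, Finset.mem_singleton]
    constructor
    · rintro ⟨p⟩
      cases p with
      | nil => rfl
      | cons h _ =>
        obtain ⟨e, he, -⟩ := graphOf_adj.1 h
        simp at he
    · rintro rfl
      exact SimpleGraph.Reachable.refl _
  simp [total, h]

/-- The total of the constant `1` is the number of components. -/
theorem total_one_ge_two {M : Finset (Edge n)} {u w : Fin n}
    (h : ¬ (graphOf M).Reachable u w) : 2 ≤ total M fun _ => 1 := by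
  calc (2 : ℝ) = ∑ v ∈ cls M u ∪ cls M w, (fun _ => (1 : ℝ)) (cls M v) / (cls M v).card := by
        rw [Finset.sum_union (cls_disjoint h), sum_cls M fun _ => 1, sum_cls M fun _ => 1]
        norm_num
    _ ≤ total M fun _ => 1 :=
        Finset.sum_le_univ_sum_of_nonneg fun v => by positivity

theorem total_one_of_connected {M : Finset (Edge n)} (hn : 0 < n)
    (h : ∀ u w, (graphOf M).Reachable u w) : total M (fun _ => 1) = 1 := by
  have := sum_cls M (fun _ => 1) ⟨0, hn⟩
  have hu : cls M ⟨0, hn⟩ = Finset.univ := by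
    ext x; simp [mem_cls, h]
  rw [hu] at this
  exact this

theorem apply_cls_le_total {M : Finset (Edge n)} {F : Finset (Fin n) → ℝ}
    (h : ∀ v, 0 ≤ F (cls M v)) (u : Fin n) : F (cls M u) ≤ total M F := by
  rw [← sum_cls M F u]
  exact Finset.sum_le_univ_sum_of_nonneg fun v => div_nonneg (h v) (by positivity)

theorem exists_small_class {M : Finset (Edge n)} {u w : Fin n}
    (h : ¬ (graphOf M).Reachable u w) : ∃ v, 2 * (cls M v).card ≤ n := by
  have h1 := Finset.card_le_univ (cls M u ∪ cls M w)
  rw [Finset.card_union_of_disjoint (cls_disjoint h), Fintype.card_fin] at h1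
  by_cases h2 : 2 * (cls M u).card ≤ n
  · exact ⟨u, h2⟩
  · exact ⟨w, by omega⟩

end Components

/-! ### Maker's move and the fall of the potential. -/

section Potential
open scoped Classical

variable {n : ℕ}

/-- As with Kruskal's algorithm, a Maker edge `g` costlier than `e` can be dropped without
disconnecting the ends of `e`: in the cut `A` where `g` is cheapest, neither `e` nor any Maker edge
cheaper than `g` crosses, so no path between the ends of `e` needs `g`. The costliest edges are
removed one at a time. -/
theorem spans_low {l key : Edge n → ℕ} (hinj : Function.Injective key)
    (hkey : ∀ e e', l e < l e' → key e < key e') {M B : Finset (Edge n)} (hMB : Disjoint M B)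
    (hcut : ∀ g ∈ M, ∃ A, Crosses A g ∧ ∀ h, h ∉ B → Crosses A h → key g ≤ key h)
    {e : Edge n} (heB : e ∉ B) (he : Spans M e) : Spans (low l (l e) M) e := by
  have step : ∀ k, Spans (M.filter fun g => key g < k) e →
      Spans (M.filter fun g => key g ≤ key e) e := by
    intro k
    induction k with
    | zero => exact fun h => spans_mono (by intro g; simp) h
    | succ k ih =>
      intro h
      by_cases hk : k ≤ key e
      · refine spans_mono ?_ h
        intro g
        simp only [Finset.mem_filter]
        exact fun h' => ⟨h'.1, by omega⟩
      by_cases hg : ∃ g ∈ M, key g = k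
      swap
      · refine ih (spans_mono ?_ h)
        intro g
        simp only [Finset.mem_filter]
        refine fun h' => ⟨h'.1, lt_of_le_of_ne (by omega) fun h'' => hg ⟨g, h'.1, h''⟩⟩
      obtain ⟨g, hgM, rfl⟩ := hg
      obtain ⟨u, w, huw, -⟩ := edge_ends e
      obtain ⟨a, c, hac, -⟩ := edge_ends g
      have hsub : (M.filter fun h => key h < key g + 1) ⊆
          insert g (M.filter fun h => key h < key g) := by
        intro h
        simp only [Finset.mem_filter, Finset.mem_insert]
        rintro ⟨h1, h2⟩
        rcases eq_or_ne (key h) (key g) with h3 | h3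
        · exact Or.inl (hinj h3)
        · exact Or.inr ⟨h1, by omega⟩
      have hr := (spans_mono hsub h) u w huw
      rw [reachable_insert hac] at hr
      obtain ⟨A, hA, hmin⟩ := hcut g hgM
      have hno : ∀ h ∈ M.filter (fun h => key h < key g), ¬ Crosses A h := by
        intro h hh hc
        rw [Finset.mem_filter] at hh
        have := hmin h (Finset.disjoint_left.1 hMB hh.1) hc
        omega
      have hce : ¬ Crosses A e := fun hc => by
        have := hmin e heB hc
        omega
      have hgA : (a ∈ A ∧ c ∉ A) ∨ (c ∈ A ∧ a ∉ A) := by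
        obtain ⟨x, y, hxy, hx, hy⟩ := hA
        rw [hac, Sym2.eq_iff] at hxy
        rcases hxy with ⟨rfl, rfl⟩ | ⟨rfl, rfl⟩
        · exact Or.inl ⟨hx, hy⟩
        · exact Or.inr ⟨hx, hy⟩
      have heA : u ∈ A ↔ w ∈ A := by
        constructor
        · intro hu
          by_contra hw
          exact hce ⟨u, w, huw, hu, hw⟩
        · intro hw
          by_contra hu
          exact hce ⟨w, u, by rw [huw, Sym2.eq_swap], hw, hu⟩
      -- A path through `g` would change sides of `A` exactly once, while the ends of `e` lie on the
      -- same side.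
      rcases hr with hr | ⟨h1, h2⟩ | ⟨h1, h2⟩
      · exact ih (spans_of_reachable huw hr)
      · have h3 := mem_iff_of_reachable hno h1
        have h4 := mem_iff_of_reachable hno h2
        tauto
      · have h3 := mem_iff_of_reachable hno h1
        have h4 := mem_iff_of_reachable hno h2
        tauto
  have h1 : Spans (M.filter fun g => key g ≤ key e) e := by
    refine step (M.sup key + 1) (spans_mono ?_ he)
    intro g hg
    rw [Finset.mem_filter]
    exact ⟨hg, Nat.lt_succ_of_le (Finset.le_sup hg)⟩
  refine spans_mono ?_ h1
  intro g
  simp only [low, Finset.mem_filter]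
  rintro ⟨h2, h3⟩
  refine ⟨h2, ?_⟩
  by_contra h4
  have := hkey e g (by omega)
  omega

/-- On the union of disjoint sets, `F` is at most the average of its two values, weighted by the
sizes of the sets. -/
def Averages (F : Finset (Fin n) → ℝ) : Prop :=
  (∀ A, 0 ≤ F A) ∧ ∀ A A' : Finset (Fin n), A.Nonempty → A'.Nonempty → Disjoint A A' →
    F (A ∪ A') ≤ (A.card * F A + A'.card * F A') / (A.card + A'.card)

/-- The share of the vertex `v` in `total M F`. -/
noncomputable def share (M : Finset (Edge n)) (F : Finset (Fin n) → ℝ) (v : Fin n) : ℝ :=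
  F (cls M v) / (cls M v).card

theorem share_nonneg {F : Finset (Fin n) → ℝ} (hF : Averages F) (M : Finset (Edge n)) (v : Fin n) :
    0 ≤ share M F v := div_nonneg (hF.1 _) (by positivity)

theorem share_eq_of_mem {M : Finset (Edge n)} {u v : Fin n} (F : Finset (Fin n) → ℝ)
    (h : u ∈ cls M v) : share M F u = share M F v := by
  unfold share
  rw [cls_eq_of_mem h]

/-- For components of sizes `s`, `t`, replacing the two values by their weighted average loses at
least `s * t / (s + t)` times the sum of the shares, and this factor is at least `1 / 2`. -/
theorem total_insert_le {F : Finset (Fin n) → ℝ} (hF : Averages F) {M : Finset (Edge n)}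
    {f : Edge n} {u w : Fin n} (hf : (f : Sym2 (Fin n)) = s(u, w))
    (h : ¬ (graphOf M).Reachable u w) :
    (share M F u + share M F w) / 2 + total (insert f M) F ≤ total M F := by
  rw [total_insert hf h]
  have h1 := hF.2 _ _ (cls_nonempty M u) (cls_nonempty M w) (cls_disjoint h)
  have hs : (1 : ℝ) ≤ (cls M u).card := by exact_mod_cast cls_card_pos M u
  have ht : (1 : ℝ) ≤ (cls M w).card := by exact_mod_cast cls_card_pos M w
  have hx := hF.1 (cls M u)
  have hy := hF.1 (cls M w)
  unfold share
  generalize F (cls M u ∪ cls M w) = z at *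
  generalize F (cls M u) = x at *
  generalize F (cls M w) = y at *
  generalize ((cls M u).card : ℝ) = s at *
  generalize ((cls M w).card : ℝ) = t at *
  have h2 : (x / s + y / t) / 2 + (s * x + t * y) / (s + t) ≤ x + y := by
    have h3 : x + y - ((x / s + y / t) / 2 + (s * x + t * y) / (s + t)) =
        (x / s + y / t) * (2 * s * t - s - t) / (2 * (s + t)) := by
      field_simp
      ring
    have h4 : 0 ≤ 2 * s * t - s - t := by nlinarith
    have h5 : 0 ≤ (x / s + y / t) * (2 * s * t - s - t) / (2 * (s + t)) := by positivity
    linarith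
  linarith

theorem share_insert_le {F : Finset (Fin n) → ℝ} (hF : Averages F) {M : Finset (Edge n)}
    {f : Edge n} {u w : Fin n} (hf : (f : Sym2 (Fin n)) = s(u, w))
    (h : ¬ (graphOf M).Reachable u w) (v : Fin n) :
    share (insert f M) F v ≤ share M F v + (share M F u + share M F w) := by
  have hu := share_nonneg hF M u
  have hw := share_nonneg hF M w
  have hv := share_nonneg hF M v
  by_cases hm : v ∈ cls M u ∪ cls M w
  swap
  · unfold share at *
    rw [cls_insert_of_notMem hf hm]
    linarith
  have h1 := hF.2 _ _ (cls_nonempty M u) (cls_nonempty M w) (cls_disjoint h)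
  suffices share (insert f M) F v ≤ share M F u + share M F w by linarith
  have hs : (1 : ℝ) ≤ (cls M u).card := by exact_mod_cast cls_card_pos M u
  have ht : (1 : ℝ) ≤ (cls M w).card := by exact_mod_cast cls_card_pos M w
  have hx := hF.1 (cls M u)
  have hy := hF.1 (cls M w)
  unfold share
  rw [cls_insert_of_mem hf hm, Finset.card_union_of_disjoint (cls_disjoint h)]
  push_cast
  generalize F (cls M u ∪ cls M w) = z at *
  generalize F (cls M u) = x at *
  generalize F (cls M w) = y at *
  generalize ((cls M u).card : ℝ) = s at *
  generalize ((cls M w).card : ℝ) = t at *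
  have h2 : s * x / (s + t) ≤ x := by
    rw [div_le_iff₀ (by positivity)]
    nlinarith
  have h3 : t * y / (s + t) ≤ y := by
    rw [div_le_iff₀ (by positivity)]
    nlinarith
  have h4 : z ≤ x + y := by
    rw [add_div] at h1
    linarith
  rw [div_le_iff₀ (by positivity)]
  have h5 : (x / s + y / t) * (s + t) = x + y + (x * t / s + y * s / t) := by
    field_simp
    ring
  have h6 : 0 ≤ x * t / s + y * s / t := by positivity
  linarith

theorem low_insert_of_le {l : Edge n → ℕ} {i : ℕ} {M : Finset (Edge n)} {f : Edge n}
    (h : l f ≤ i) : low l i (insert f M) = insert f (low l i M) := by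
  unfold low
  rw [Finset.filter_insert, if_pos h]

theorem low_insert_of_lt {l : Edge n → ℕ} {i : ℕ} {M : Finset (Edge n)} {f : Edge n}
    (h : i < l f) : low l i (insert f M) = low l i M := by
  unfold low
  rw [Finset.filter_insert, if_neg (not_le.2 h)]

/-- The weighted sum of the totals over the levels below `N`. -/
noncomputable def potential (l : Edge n → ℕ) (N : ℕ) (w : ℕ → ℝ)
    (F : ℕ → Finset (Fin n) → ℝ) (M : Finset (Edge n)) : ℝ :=
  ∑ i ∈ Finset.range N, w i * total (low l i M) (F i)

/-- The share of the vertex `v` in the potential of the levels from `j` on. -/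
noncomputable def danger (l : Edge n → ℕ) (N : ℕ) (w : ℕ → ℝ)
    (F : ℕ → Finset (Fin n) → ℝ) (M : Finset (Edge n)) (v : Fin n) (j : ℕ) : ℝ :=
  ∑ i ∈ Finset.range N, if j ≤ i then w i * share (low l i M) (F i) v else 0

/-- If `e₀` has maximal danger and `f` is the cheapest edge leaving the component of its owner at
level `l e₀`, then `f` has an end in that component at all levels from `l e₀` on, so the danger of
`e₀` is at most twice the drop. The merge adds to any other danger at most twice the drop again,
whence the factor `4`. -/
theorem exists_maker_move {l key : Edge n → ℕ} {owner : Edge n → Fin n}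
    (howner : ∀ e : Edge n, owner e ∈ (e : Sym2 (Fin n)))
    (hinj : Function.Injective key)
    (hkey : ∀ e e', l e < l e' → key e < key e') {N : ℕ} {w : ℕ → ℝ} (hw : ∀ i, 0 ≤ w i)
    {F : ℕ → Finset (Fin n) → ℝ} (hF : ∀ i, Averages (F i))
    {M B : Finset (Edge n)} (hMB : Disjoint M B)
    (hcut : ∀ g ∈ M, ∃ A, Crosses A g ∧ ∀ h, h ∉ B → Crosses A h → key g ≤ key h)
    (hex : ∃ e, e ∉ B ∧ ¬ Spans M e) :
    ∃ (f : Edge n) (u v : Fin n), (f : Sym2 (Fin n)) = s(u, v) ∧ f ∉ B ∧ ¬ (graphOf M).Reachable u v ∧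
      (∃ A, Crosses A f ∧ ∀ h, h ∉ B → Crosses A h → key f ≤ key h) ∧
      ∀ e, e ∉ B → ¬ Spans (insert f M) e →
        danger l N w F (insert f M) (owner e) (l e) ≤
          4 * (potential l N w F M - potential l N w F (insert f M)) := by
  have hle : ∀ e e', key e ≤ key e' → l e ≤ l e' := by
    intro e e' h
    by_contra h'
    have := hkey e' e (by omega)
    omega
  obtain ⟨e₀, he₀, hmax⟩ := Finset.exists_max_image
    (Finset.univ.filter fun e => e ∉ B ∧ ¬ Spans M e)
    (fun e => danger l N w F M (owner e) (l e)) (by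
      obtain ⟨e, he⟩ := hex
      exact ⟨e, by simpa using he⟩)
  simp only [Finset.mem_filter, Finset.mem_univ, true_and] at he₀ hmax
  set P := cls (low l (l e₀) M) (owner e₀) with hP
  have hcr : Crosses P e₀ := by
    obtain ⟨y, hy⟩ := howner e₀
    refine ⟨owner e₀, y, hy, self_mem_cls _ _, fun h => he₀.2 ?_⟩
    exact spans_of_reachable hy ((mem_cls.1 h).mono (graphOf_mono (low_subset _ _ _)))
  obtain ⟨f, hf, hmin⟩ := Finset.exists_min_image
    (Finset.univ.filter fun e => e ∉ B ∧ Crosses P e) key ⟨e₀, by simpa using ⟨he₀.1, hcr⟩⟩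
  simp only [Finset.mem_filter, Finset.mem_univ, true_and] at hf hmin
  have hlf : l f ≤ l e₀ := hle _ _ (hmin e₀ ⟨he₀.1, hcr⟩)
  obtain ⟨u, v, huv, hu, hv⟩ := hf.2
  -- Otherwise `f` would already be spanned at level `l f ≤ l e₀` and could not leave `P`.
  have hnr : ¬ (graphOf M).Reachable u v := by
    intro hr
    have h1 := spans_low hinj hkey hMB hcut hf.1 (spans_of_reachable huv hr)
    exact not_crosses_of_spans (spans_mono (low_mono hlf M) h1) _ hf.2
  have hnr' : ∀ i, ¬ (graphOf (low l i M)).Reachable u v := fun i h =>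
    hnr (h.mono (graphOf_mono (low_subset _ _ _)))
  have hdrop : ∀ i, (if l f ≤ i then
      w i * ((share (low l i M) (F i) u + share (low l i M) (F i) v) / 2) else 0) ≤
      w i * total (low l i M) (F i) - w i * total (low l i (insert f M)) (F i) := by
    intro i
    split_ifs with hi
    · rw [low_insert_of_le hi, ← mul_sub]
      have := total_insert_le (hF i) huv (hnr' i)
      exact mul_le_mul_of_nonneg_left (by linarith) (hw i)
    · rw [low_insert_of_lt (not_le.1 hi), sub_self]
  have hsum : ∑ i ∈ Finset.range N, (if l f ≤ i then
      w i * ((share (low l i M) (F i) u + share (low l i M) (F i) v) / 2) else 0) ≤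
      potential l N w F M - potential l N w F (insert f M) := by
    unfold potential
    rw [← Finset.sum_sub_distrib]
    exact Finset.sum_le_sum fun i _ => hdrop i
  have hd0 : danger l N w F M (owner e₀) (l e₀) ≤
      2 * (potential l N w F M - potential l N w F (insert f M)) := by
    refine le_trans ?_ (mul_le_mul_of_nonneg_left hsum zero_le_two)
    unfold danger
    rw [Finset.mul_sum]
    refine Finset.sum_le_sum fun i _ => ?_
    have h1 := share_nonneg (hF i) (low l i M) u
    have h2 := share_nonneg (hF i) (low l i M) v
    by_cases hi : l e₀ ≤ i
    · rw [if_pos hi, if_pos (hlf.trans hi), ← share_eq_of_mem (F i)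
        (cls_mono (low_mono hi M) _ hu)]
      have := mul_nonneg (hw i) h2
      linarith
    · rw [if_neg hi]
      split_ifs
      · have := mul_nonneg (hw i) h2
        have := mul_nonneg (hw i) h1
        linarith
      · simp
  refine ⟨f, u, v, huv, hf.1, hnr, ⟨P, hf.2, fun h hh hc => hmin h ⟨hh, hc⟩⟩, fun e heB he => ?_⟩
  have h1 := hmax e ⟨heB, fun h => he (spans_mono (Finset.subset_insert _ _) h)⟩
  have h2 : danger l N w F (insert f M) (owner e) (l e) ≤
      danger l N w F M (owner e) (l e) + 2 * ∑ i ∈ Finset.range N, (if l f ≤ i then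
      w i * ((share (low l i M) (F i) u + share (low l i M) (F i) v) / 2) else 0) := by
    unfold danger
    rw [Finset.mul_sum, ← Finset.sum_add_distrib]
    refine Finset.sum_le_sum fun i _ => ?_
    have h1 := mul_nonneg (hw i) (share_nonneg (hF i) (low l i M) u)
    have h2 := mul_nonneg (hw i) (share_nonneg (hF i) (low l i M) v)
    by_cases hi : l f ≤ i
    · rw [if_pos hi, low_insert_of_le hi]
      have := mul_le_mul_of_nonneg_left
        (share_insert_le (hF i) huv (hnr' i) (owner e)) (hw i)
      split_ifs <;> linarith
    · rw [if_neg hi, low_insert_of_lt (not_le.1 hi)]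
      linarith
  linarith

end Potential

/-! ### The exponential weight and Breaker's deletions. -/

section Game
open scoped Classical

variable {n : ℕ}

/-- The edges of level at most `i` that are owned by `v` and do not lie in `D`. -/
noncomputable def owned (l : Edge n → ℕ) (owner : Edge n → Fin n) (D : Finset (Edge n)) (i : ℕ)
    (v : Fin n) : Finset (Edge n) :=
  Finset.univ.filter fun e => e ∉ D ∧ owner e = v ∧ l e ≤ i

/-- An exponential weight that is at least `1` when the vertices of `P` own on average at most two
edges of level at most `i` outside `D`. -/
noncomputable def weight (l : Edge n → ℕ) (owner : Edge n → Fin n) (lam : ℝ) (D : Finset (Edge n))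
    (i : ℕ) (P : Finset (Fin n)) : ℝ :=
  Real.exp (lam * ((∑ v ∈ P, (2 - ((owned l owner D i v).card : ℝ))) / P.card))

/-- The exponent of a union is the size-weighted average of the two exponents, and `exp` is convex.
-/
theorem weight_averages (l : Edge n → ℕ) (owner : Edge n → Fin n) (lam : ℝ) (D : Finset (Edge n))
    (i : ℕ) : Averages (weight l owner lam D i) := by
  refine ⟨fun A => (Real.exp_pos _).le, fun A A' hA hA' hd => ?_⟩
  unfold weight
  rw [Finset.sum_union hd, Finset.card_union_of_disjoint hd]
  have hs : (0 : ℝ) < A.card := by exact_mod_cast hA.card_pos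
  have ht : (0 : ℝ) < A'.card := by exact_mod_cast hA'.card_pos
  push_cast
  generalize (∑ v ∈ A, (2 - ((owned l owner D i v).card : ℝ))) = x
  generalize (∑ v ∈ A', (2 - ((owned l owner D i v).card : ℝ))) = y
  generalize (A.card : ℝ) = s at *
  generalize (A'.card : ℝ) = t at *
  have h := convexOn_exp.2 (Set.mem_univ (lam * (x / s))) (Set.mem_univ (lam * (y / t)))
    (show 0 ≤ s / (s + t) by positivity) (show 0 ≤ t / (s + t) by positivity)
    (by field_simp)
  simp only [smul_eq_mul] at h
  have h1 : s / (s + t) * (lam * (x / s)) + t / (s + t) * (lam * (y / t)) =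
      lam * ((x + y) / (s + t)) := by
    field_simp
  rw [h1] at h
  refine h.trans (le_of_eq ?_)
  field_simp

/-- On `[0, b]` the exponential lies below its chord; this makes the effect of up to `b`
simultaneous deletions additive. -/
theorem exp_le_of_le {lam b x : ℝ} (hb : 0 < b) (h : Real.exp (lam * b) ≤ 5 / 4) (hx : 0 ≤ x)
    (hxb : x ≤ b) : Real.exp (lam * x) ≤ 1 + x / (4 * b) := by
  have h1 := convexOn_exp.2 (Set.mem_univ (lam * b)) (Set.mem_univ 0)
    (show 0 ≤ x / b by positivity) (show 0 ≤ 1 - x / b by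
      rw [sub_nonneg, div_le_one hb]; exact hxb) (by ring)
  simp only [smul_eq_mul, mul_zero, add_zero, Real.exp_zero, mul_one] at h1
  have h2 : x / b * (lam * b) = lam * x := by field_simp
  rw [h2] at h1
  have h3 : x / b * Real.exp (lam * b) ≤ x / b * (5 / 4) :=
    mul_le_mul_of_nonneg_left h (by positivity)
  have h4 : x / (4 * b) = x / b * (1 / 4) := by field_simp
  rw [h4]
  linarith

theorem sum_card_owned (l : Edge n → ℕ) (owner : Edge n → Fin n) (D : Finset (Edge n)) (i : ℕ)
    (P : Finset (Fin n)) : ∑ v ∈ P, (owned l owner D i v).card =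
      (Finset.univ.filter fun e => e ∉ D ∧ owner e ∈ P ∧ l e ≤ i).card := by
  rw [Finset.card_eq_sum_card_fiberwise (f := owner) (t := P)]
  · refine Finset.sum_congr rfl fun v hv => congrArg _ ?_
    ext e
    simp only [owned, Finset.mem_filter, Finset.mem_univ, true_and]
    constructor
    · rintro ⟨h1, rfl, h3⟩; exact ⟨⟨h1, hv, h3⟩, rfl⟩
    · rintro ⟨⟨h1, -, h3⟩, rfl⟩; exact ⟨h1, rfl, h3⟩
  · intro e he
    simp only [Finset.coe_filter, Set.mem_ofPred_eq] at he
    exact he.2.2.1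

theorem weight_union_le {l : Edge n → ℕ} {owner : Edge n → Fin n} {lam : ℝ} (hlam : 0 ≤ lam)
    {b : ℕ} (hb : 0 < b) (h : Real.exp (lam * b) ≤ 5 / 4) (D D₀ : Finset (Edge n))
    (hD : D₀.card ≤ b) (i : ℕ) {P : Finset (Fin n)} (hP : P.Nonempty) :
    weight l owner lam (D ∪ D₀) i P ≤ weight l owner lam D i P *
      (1 + (D₀.filter fun e => owner e ∈ P ∧ l e ≤ i).card / (4 * b * P.card)) := by
  set t := (D₀.filter fun e => owner e ∈ P ∧ l e ≤ i).card with ht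
  have hs : (1 : ℝ) ≤ P.card := by exact_mod_cast hP.card_pos
  have hb' : (0 : ℝ) < b := by exact_mod_cast hb
  have htb : (t : ℝ) ≤ b := by exact_mod_cast (Finset.card_filter_le _ _).trans hD
  have hle : ∑ v ∈ P, (owned l owner D i v).card ≤
      ∑ v ∈ P, (owned l owner (D ∪ D₀) i v).card + t := by
    rw [sum_card_owned, sum_card_owned, ht]
    refine (Finset.card_le_card ?_).trans (Finset.card_union_le _ _)
    intro e
    simp only [Finset.mem_filter, Finset.mem_univ, true_and, Finset.mem_union, not_or]
    tauto
  have hle' : (∑ v ∈ P, ((owned l owner D i v).card : ℝ)) ≤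
      ∑ v ∈ P, ((owned l owner (D ∪ D₀) i v).card : ℝ) + t := by exact_mod_cast hle
  have h1 : weight l owner lam (D ∪ D₀) i P ≤
      weight l owner lam D i P * Real.exp (lam * (t / P.card)) := by
    unfold weight
    rw [← Real.exp_add, Real.exp_le_exp, ← mul_add, ← add_div]
    refine mul_le_mul_of_nonneg_left (div_le_div_of_nonneg_right ?_ (by positivity)) hlam
    rw [Finset.sum_sub_distrib, Finset.sum_sub_distrib]
    linarith
  refine h1.trans (mul_le_mul_of_nonneg_left ?_ (Real.exp_pos _).le)
  refine (exp_le_of_le hb' h (by positivity) ((div_le_self (by positivity) hs).trans htb)).trans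
    (le_of_eq ?_)
  field_simp

/-- Dividing the increase of a weight by the size of its component turns it into the owner's share,
so each deleted edge is charged to its owner alone. -/
theorem total_weight_union_le {l : Edge n → ℕ} {owner : Edge n → Fin n} {lam : ℝ}
    (hlam : 0 ≤ lam) {b : ℕ} (hb : 0 < b) (h : Real.exp (lam * b) ≤ 5 / 4)
    (D D₀ : Finset (Edge n)) (hD : D₀.card ≤ b) (i : ℕ) (M : Finset (Edge n)) :
    total M (weight l owner lam (D ∪ D₀) i) ≤ total M (weight l owner lam D i) +
      1 / (4 * b) * ∑ e ∈ D₀, if l e ≤ i then share M (weight l owner lam D i) (owner e) else 0 := by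
  have hb' : (0 : ℝ) < b := by exact_mod_cast hb
  set F := weight l owner lam D i with hF
  have h1 : ∀ v, share M (weight l owner lam (D ∪ D₀) i) v ≤ share M F v +
      1 / (4 * b) * ∑ e ∈ D₀, if l e ≤ i then
        (if owner e ∈ cls M v then share M F v / (cls M v).card else 0) else 0 := by
    intro v
    have h2 := weight_union_le (l := l) (owner := owner) hlam hb h D D₀ hD i (cls_nonempty M v)
    have hc : (0 : ℝ) < (cls M v).card := by exact_mod_cast cls_card_pos M v
    have h3 : (∑ e ∈ D₀, if l e ≤ i then
        (if owner e ∈ cls M v then share M F v / (cls M v).card else 0) else 0) =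
        (D₀.filter fun e => owner e ∈ cls M v ∧ l e ≤ i).card * (share M F v / (cls M v).card) := by
      rw [← nsmul_eq_mul, ← Finset.sum_const, Finset.sum_filter]
      refine Finset.sum_congr rfl fun e _ => ?_
      by_cases h4 : l e ≤ i <;> simp [h4]
    rw [h3]
    unfold share at *
    rw [div_le_iff₀ hc]
    refine h2.trans (le_of_eq ?_)
    field_simp
    rfl
  calc total M (weight l owner lam (D ∪ D₀) i)
      = ∑ v, share M (weight l owner lam (D ∪ D₀) i) v := rfl
    _ ≤ ∑ v, (share M F v + 1 / (4 * b) * ∑ e ∈ D₀, if l e ≤ i then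
        (if owner e ∈ cls M v then share M F v / (cls M v).card else 0) else 0) :=
        Finset.sum_le_sum fun v _ => h1 v
    _ = total M F + 1 / (4 * b) * ∑ e ∈ D₀, if l e ≤ i then share M F (owner e) else 0 := by
        rw [Finset.sum_add_distrib, ← Finset.mul_sum, Finset.sum_comm]
        congr 2
        refine Finset.sum_congr rfl fun e _ => ?_
        split_ifs with hl
        swap
        · simp
        have h4 := sum_cls M (fun P => F P / P.card) (owner e)
        rw [show share M F (owner e) = F (cls M (owner e)) / (cls M (owner e)).card from rfl, ← h4,
          ← Finset.sum_filter]
        refine Finset.sum_congr ?_ fun v _ => rfl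
        ext v
        rw [Finset.mem_filter]
        simp only [Finset.mem_univ, true_and, mem_cls]
        exact ⟨fun h => h.symm, fun h => h.symm⟩

/-- Each of at most `b` deletions costs `1 / (4 * b)` of its danger, which is at most `4 * d`; with
`d` the drop won by Maker's move, a full round does not raise the potential. -/
theorem potential_union_le {l : Edge n → ℕ} {owner : Edge n → Fin n} {lam : ℝ}
    (hlam : 0 ≤ lam) {b : ℕ} (hb : 0 < b) (h : Real.exp (lam * b) ≤ 5 / 4) {N : ℕ} {w : ℕ → ℝ}
    (hw : ∀ i, 0 ≤ w i) (D D₀ : Finset (Edge n)) (hD : D₀.card ≤ b) (M : Finset (Edge n)) {d : ℝ}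
    (hd : 0 ≤ d)
    (hdanger : ∀ e ∈ D₀, danger l N w (weight l owner lam D) M (owner e) (l e) ≤ 4 * d) :
    potential l N w (weight l owner lam (D ∪ D₀)) M ≤
      potential l N w (weight l owner lam D) M + d := by
  have hb' : (0 : ℝ) < b := by exact_mod_cast hb
  have h1 : potential l N w (weight l owner lam (D ∪ D₀)) M ≤
      potential l N w (weight l owner lam D) M +
        1 / (4 * b) * ∑ e ∈ D₀, danger l N w (weight l owner lam D) M (owner e) (l e) := by
    unfold potential danger
    rw [Finset.sum_comm, Finset.mul_sum, ← Finset.sum_add_distrib]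
    refine Finset.sum_le_sum fun i _ => ?_
    refine (mul_le_mul_of_nonneg_left
      (total_weight_union_le hlam hb h D D₀ hD i (low l i M)) (hw i)).trans (le_of_eq ?_)
    rw [mul_add, mul_left_comm, Finset.mul_sum]
    congr 2
    refine Finset.sum_congr rfl fun e _ => ?_
    split_ifs <;> simp
  have h2 : ∑ e ∈ D₀, danger l N w (weight l owner lam D) M (owner e) (l e) ≤ b * (4 * d) := by
    refine (Finset.sum_le_sum hdanger).trans ?_
    rw [Finset.sum_const, nsmul_eq_mul]
    exact mul_le_mul_of_nonneg_right (by exact_mod_cast hD) (by positivity)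
  have h3 : 1 / (4 * b) * ∑ e ∈ D₀, danger l N w (weight l owner lam D) M (owner e) (l e) ≤ d := by
    refine (mul_le_mul_of_nonneg_left h2 (by positivity)).trans (le_of_eq ?_)
    field_simp
  linarith

end Game

/-! ### The invariant of the game and the deterministic bound on the cost. -/

section Strategy
open scoped Classical

variable {n : ℕ}

/-- The position in which Maker owns `M` and `B` is deleted is under Maker's control: `D` consists
of the deleted edges that joined different components of Maker's graph when they were deleted. -/
structure Controlled (b : ℕ) (l key : Edge n → ℕ) (owner : Edge n → Fin n) (lam : ℝ) (N : ℕ)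
    (w : ℕ → ℝ) (K : ℝ) (M B D : Finset (Edge n)) : Prop where
  disj : Disjoint M B
  sub : D ⊆ B
  spans : ∀ e ∈ B, e ∉ D → Spans (low l (l e) M) e
  cut : ∀ g ∈ M, ∃ A, Crosses A g ∧ ∀ h, h ∉ B → Crosses A h → key g ≤ key h
  card_le : B.card ≤ b * M.card
  count : ∀ i, total (low l i M) (fun _ => 1) + (low l i M).card = n
  pot : potential l N w (weight l owner lam D) M ≤ K

/-- The properties of the levels of the edges under which Maker's strategy works. -/
structure GoodLevels (n b a L Y : ℕ) (l : Edge n → ℕ) : Prop where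
  le : L ≤ Y
  sparse : ∀ S : Finset (Fin n), S.card * a < n →
    (Finset.univ.filter fun e : Edge n => (∀ x ∈ (e : Sym2 (Fin n)), x ∈ S) ∧ l e ≤ L).card ≤
      2 * S.card
  expand : ∀ S : Finset (Fin n), n ≤ S.card * a → 2 * S.card ≤ n →
    b * n < (Finset.univ.filter fun e : Edge n => Crosses S e ∧ l e ≤ Y).card

theorem low_of_le {l : Edge n → ℕ} {i : ℕ} {M : Finset (Edge n)} (h : M.sup l ≤ i) :
    low l i M = M :=
  Finset.filter_true_of_mem fun _ he => (Finset.le_sup he).trans h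

section

variable {b : ℕ} {l key : Edge n → ℕ} {owner : Edge n → Fin n} {lam : ℝ} {w : ℕ → ℝ}
  {K : ℝ} {M B D : Finset (Edge n)} {a L Y N : ℕ}

theorem Controlled.card_le_n (hC : Controlled b l key owner lam N w K M B D) : M.card ≤ n := by
  have h := hC.count (M.sup l)
  rw [low_of_le le_rfl] at h
  have h0 : 0 ≤ total M fun _ => 1 := Finset.sum_nonneg fun v _ => by positivity
  have : (M.card : ℝ) ≤ n := by linarith
  exact_mod_cast this

theorem Controlled.spans_low_of_notMem (hinj : Function.Injective key)
    (hkey : ∀ e e', l e < l e' → key e < key e')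
    (hC : Controlled b l key owner lam N w K M B D)
    (hdead : ∀ e, e ∉ B → Spans M e) {e : Edge n} (he : e ∉ D) : Spans (low l (l e) M) e := by
  by_cases heB : e ∈ B
  · exact hC.spans e heB he
  · exact spans_low hinj hkey hC.disj hC.cut heB (hdead e heB)

/-- Once no useful edge is left, the edges of level at most `i` outside `D` that are owned in a
level-`i` component lie inside it. By sparsity there are at most two per vertex, so the exponent is
nonnegative. -/
theorem Controlled.one_le_weight (hinj : Function.Injective key)
    (howner : ∀ e : Edge n, owner e ∈ (e : Sym2 (Fin n)))
    (hkey : ∀ e e', l e < l e' → key e < key e') (hlam : 0 ≤ lam)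
    (hC : Controlled b l key owner lam N w K M B D) (hl : GoodLevels n b a L Y l)
    (hdead : ∀ e, e ∉ B → Spans M e) {i : ℕ} (hi : i ≤ L) (v : Fin n)
    (hv : (cls (low l i M) v).card * a < n) :
    1 ≤ weight l owner lam D i (cls (low l i M) v) := by
  set P := cls (low l i M) v with hP
  have h1 : ∑ v ∈ P, (owned l owner D i v).card ≤ 2 * P.card := by
    rw [sum_card_owned]
    refine (Finset.card_le_card ?_).trans (hl.sparse P hv)
    intro e
    simp only [Finset.mem_filter, Finset.mem_univ, true_and]
    rintro ⟨heD, heP, hei⟩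
    refine ⟨fun x hx => ?_, hei.trans hi⟩
    by_contra hxP
    have h2 := spans_mono (low_mono hei M) (hC.spans_low_of_notMem hinj hkey hdead heD)
    refine not_crosses_of_spans h2 v ⟨owner e, x, ?_, heP, hxP⟩
    refine ((Sym2.mem_and_mem_iff ?_).1 ⟨howner e, hx⟩)
    rintro rfl
    exact hxP heP
  have h1' : (∑ v ∈ P, ((owned l owner D i v).card : ℝ)) ≤ 2 * P.card := by exact_mod_cast h1
  unfold weight
  rw [← Real.exp_zero, Real.exp_le_exp]
  refine mul_nonneg hlam (div_nonneg ?_ (by positivity))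
  rw [Finset.sum_sub_distrib, Finset.sum_const, nsmul_eq_mul]
  linarith

/-- A small component at level `L` would alone contribute `w L > K` to the potential; at higher
levels components only grow. -/
theorem Controlled.not_small (hinj : Function.Injective key)
    (howner : ∀ e : Edge n, owner e ∈ (e : Sym2 (Fin n)))
    (hkey : ∀ e e', l e < l e' → key e < key e') (hlam : 0 ≤ lam)
    (hw : ∀ i, 0 ≤ w i) (hK : K < w L) (hLN : L < N)
    (hC : Controlled b l key owner lam N w K M B D) (hl : GoodLevels n b a L Y l)
    (hdead : ∀ e, e ∉ B → Spans M e) {i : ℕ} (hi : L ≤ i) (v : Fin n) :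
    n ≤ (cls (low l i M) v).card * a := by
  by_contra! h
  have h1 : (cls (low l L M) v).card * a < n :=
    (Nat.mul_le_mul_right a (Finset.card_le_card (cls_mono (low_mono hi M) v))).trans_lt h
  have h2 := hC.one_le_weight hinj howner hkey hlam hl hdead le_rfl v h1
  have hA := weight_averages l owner lam D
  have h3 := apply_cls_le_total (M := low l L M) (fun v => (hA L).1 (cls (low l L M) v)) v
  have h4 : w L * total (low l L M) (weight l owner lam D L) ≤
      potential l N w (weight l owner lam D) M := by
    unfold potential
    refine Finset.single_le_sum (f := fun i => w i * total (low l i M) (weight l owner lam D i))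
      (fun j _ => mul_nonneg (hw j) ?_) (Finset.mem_range.2 hLN)
    exact Finset.sum_nonneg fun v _ => share_nonneg (hA j) _ v
  have h5 : w L * 1 ≤ w L * total (low l L M) (weight l owner lam D L) :=
    mul_le_mul_of_nonneg_left (h2.trans h3) (hw L)
  linarith [hC.pot]

/-- Otherwise some component at level `Y` has at most half of the vertices. It is not small, so more
than `b * n` edges of level at most `Y` leave it, all of them deleted: too many for Breaker. -/
theorem Controlled.reachable_low (hinj : Function.Injective key)
    (howner : ∀ e : Edge n, owner e ∈ (e : Sym2 (Fin n)))
    (hkey : ∀ e e', l e < l e' → key e < key e') (hlam : 0 ≤ lam)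
    (hw : ∀ i, 0 ≤ w i) (hK : K < w L) (hLN : L < N)
    (hC : Controlled b l key owner lam N w K M B D) (hl : GoodLevels n b a L Y l)
    (hdead : ∀ e, e ∉ B → Spans M e) (u v : Fin n) : (graphOf (low l Y M)).Reachable u v := by
  by_contra h
  obtain ⟨x, hx⟩ := exists_small_class h
  have h1 := hC.not_small hinj howner hkey hlam hw hK hLN hl hdead hl.le x
  have h2 := hl.expand _ h1 hx
  have h3 : (Finset.univ.filter fun e : Edge n => Crosses (cls (low l Y M) x) e ∧ l e ≤ Y) ⊆ B := by
    intro e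
    simp only [Finset.mem_filter, Finset.mem_univ, true_and]
    rintro ⟨hc, he⟩
    by_contra heB
    have h4 := spans_low hinj hkey hC.disj hC.cut heB (hdead e heB)
    exact not_crosses_of_spans (spans_mono (low_mono he M) h4) x hc
  have h4 := Finset.card_le_card h3
  have h5 := hC.card_le
  have h6 := Nat.mul_le_mul_left b hC.card_le_n
  omega

theorem Controlled.step (hinj : Function.Injective key)
    (howner : ∀ e : Edge n, owner e ∈ (e : Sym2 (Fin n)))
    (hkey : ∀ e e', l e < l e' → key e < key e') (hlam : 0 ≤ lam) (hb : 0 < b)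
    (hexp : Real.exp (lam * b) ≤ 5 / 4)
    (hw : ∀ i, 0 ≤ w i) (hK : K < w L) (hLN : L < N)
    (hC : Controlled b l key owner lam N w K M B D) (hl : GoodLevels n b a L Y l)
    (hM : M.card + 1 < n) :
    ∃ f, f ∉ M ∧ f ∉ B ∧ ∀ D' : Finset (Edge n), D'.card ≤ b → Disjoint D' (insert f M) →
      ∃ D'', Controlled b l key owner lam N w K (insert f M) (B ∪ D') D'' := by
  have hex : ∃ e, e ∉ B ∧ ¬ Spans M e := by
    by_contra! hdead
    have h1 : ∀ u v, (graphOf M).Reachable u v := fun u v =>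
      (hC.reachable_low hinj howner hkey hlam hw hK hLN hl hdead u v).mono
        (graphOf_mono (low_subset _ _ _))
    have h2 := hC.count (M.sup l)
    rw [low_of_le le_rfl, total_one_of_connected (by omega) h1] at h2
    have h3 : 1 + M.card = n := by exact_mod_cast h2
    omega
  have hA := weight_averages l owner lam D
  obtain ⟨f, u, v, huv, hfB, hnr, hfcut, hdanger⟩ :=
    exists_maker_move (N := N) howner hinj hkey hw hA hC.disj hC.cut hex
  have hfM : f ∉ M := fun h => hnr (spans_of_mem h u v huv)
  have hnr' : ∀ i, ¬ (graphOf (low l i M)).Reachable u v := fun i h =>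
    hnr (h.mono (graphOf_mono (low_subset _ _ _)))
  refine ⟨f, hfM, hfB, fun D' hD' hdisj => ?_⟩
  -- Deleting an edge that Maker already spans does not hurt her; only the others enter `D` and
  -- raise the potential.
  set D₀ := D'.filter fun e => e ∉ B ∧ ¬ Spans (insert f M) e with hD₀
  have hdisj' : Disjoint (insert f M) (B ∪ D') := by
    rw [Finset.disjoint_union_right]
    refine ⟨?_, hdisj.symm⟩
    rw [Finset.disjoint_insert_left]
    exact ⟨hfB, hC.disj⟩
  have hBdisj : Disjoint (insert f M) B := hdisj'.mono_right Finset.subset_union_left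
  have hcut' : ∀ g ∈ insert f M, ∃ A, Crosses A g ∧ ∀ h, h ∉ B → Crosses A h → key g ≤ key h := by
    intro g hg
    rcases Finset.mem_insert.1 hg with rfl | hg
    · exact hfcut
    · exact hC.cut g hg
  refine ⟨D ∪ D₀, hdisj', ?_, ?_, ?_, ?_, ?_, ?_⟩
  · exact Finset.union_subset_union hC.sub (Finset.filter_subset _ _)
  · intro e he heD
    rw [Finset.mem_union, not_or] at heD
    by_cases heB : e ∈ B
    · exact spans_mono (low_mono_right (Finset.subset_insert _ _)) (hC.spans e heB heD.1)
    · have heD' : e ∈ D' := (Finset.mem_union.1 he).resolve_left heB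
      have hs : Spans (insert f M) e := by
        by_contra hs
        exact heD.2 (Finset.mem_filter.2 ⟨heD', heB, hs⟩)
      exact spans_low hinj hkey hBdisj hcut' heB hs
  · intro g hg
    obtain ⟨A, h1, h2⟩ := hcut' g hg
    exact ⟨A, h1, fun h hh => h2 h fun h' => hh (Finset.mem_union_left _ h')⟩
  · rw [Finset.card_insert_of_notMem hfM, mul_add, mul_one]
    exact (Finset.card_union_le _ _).trans (Nat.add_le_add hC.card_le hD')
  · intro i
    have h1 := hC.count i
    by_cases hi : l f ≤ i
    · rw [low_insert_of_le hi, total_insert huv (hnr' i), Finset.card_insert_of_notMem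
        fun h => hfM (low_subset _ _ _ h)]
      push_cast
      linarith
    · rw [low_insert_of_lt (not_le.1 hi)]
      exact h1
  · have hdrop : 0 ≤ potential l N w (weight l owner lam D) M -
        potential l N w (weight l owner lam D) (insert f M) := by
      unfold potential
      rw [← Finset.sum_sub_distrib]
      refine Finset.sum_nonneg fun i _ => ?_
      by_cases hi : l f ≤ i
      · rw [low_insert_of_le hi, ← mul_sub]
        have h1 := total_insert_le (hA i) huv (hnr' i)
        have h2 := share_nonneg (hA i) (low l i M) u
        have h3 := share_nonneg (hA i) (low l i M) v
        exact mul_nonneg (hw i) (by linarith)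
      · rw [low_insert_of_lt (not_le.1 hi), sub_self]
    have h1 := potential_union_le (l := l) (owner := owner) (N := N) hlam hb hexp hw D D₀
      ((Finset.card_filter_le _ _).trans hD') (insert f M) hdrop (by
        intro e he
        rw [hD₀, Finset.mem_filter] at he
        exact hdanger e he.2.1 he.2.2)
    linarith [hC.pot]

/-- At the highest level in use, `count` says that components and edges together number `n`, so `n -
1` edges leave one component. -/
theorem Controlled.isTree (hn : 0 < n) (hC : Controlled b l key owner lam N w K M B D)
    (hM : M.card + 1 = n) : (graphOf M).IsTree := by
  have h2 := hC.count (M.sup l)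
  rw [low_of_le le_rfl] at h2
  have hM' : (M.card : ℝ) + 1 = n := by exact_mod_cast hM
  have hconn : ∀ u v, (graphOf M).Reachable u v := by
    intro u v
    by_contra h
    have := total_one_ge_two h
    linarith
  have : Nonempty (Fin n) := ⟨⟨0, hn⟩⟩
  rw [SimpleGraph.isTree_iff_connected_and_card]
  refine ⟨⟨hconn⟩, ?_⟩
  have h3 : (graphOf M).edgeSet = (fun e : Edge n => (e : Sym2 (Fin n))) '' (M : Set (Edge n)) := by
    unfold graphOf
    rw [SimpleGraph.edgeSet_fromEdgeSet]
    ext x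
    simp only [Set.mem_sdiff, Set.mem_image]
    constructor
    · exact fun h => h.1
    · rintro ⟨e, he, rfl⟩
      refine ⟨⟨e, he, rfl⟩, ?_⟩
      have := SimpleGraph.not_isDiag_of_mem_edgeSet _ e.2
      simpa using this
  rw [h3, Nat.card_coe_set_eq, Set.ncard_image_of_injective _ Subtype.val_injective,
    Set.ncard_coe_finset, hM, Nat.card_fin]

/-- The sum of the levels counts, for each `i < Y`, the edges above level `i`, that is, the
components at level `i` minus one. Small components occur only below `L`, where the potential counts
them; at most `a` large ones at each level give the term `Y * a / n`. -/
theorem Controlled.sum_le (hn : 0 < n) (hinj : Function.Injective key)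
    (howner : ∀ e : Edge n, owner e ∈ (e : Sym2 (Fin n)))
    (hkey : ∀ e e', l e < l e' → key e < key e') (hlam : 0 ≤ lam)
    (hw : ∀ i, 0 ≤ w i) (hwi : ∀ i < L, w i = 1 / n) (hK : K < w L) (hLN : L < N)
    (hC : Controlled b l key owner lam N w K M B D) (hl : GoodLevels n b a L Y l)
    (hM : M.card + 1 = n) : (∑ e ∈ M, (l e : ℝ)) / n ≤ K + Y * a / n := by
  have hn' : (0 : ℝ) < n := by exact_mod_cast hn
  have htree := hC.isTree hn hM
  have hdead : ∀ e, e ∉ B → Spans M e := fun e _ u v _ => htree.1.preconnected u v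
  have hMY : low l Y M = M := by
    have h1 := hC.count Y
    rw [total_one_of_connected hn (hC.reachable_low hinj howner hkey hlam hw hK hLN hl hdead)] at h1
    have h2 : 1 + (low l Y M).card = n := by exact_mod_cast h1
    exact Finset.eq_of_subset_of_card_le (low_subset _ _ _) (by omega)
  have hA := weight_averages l owner lam D
  have htot : ∀ i, 0 ≤ total (low l i M) (weight l owner lam D i) := fun i =>
    Finset.sum_nonneg fun v _ => share_nonneg (hA i) _ v
  have hsmall : ∀ i, total (low l i M) (fun _ => 1) ≤
      (if i < L then total (low l i M) (weight l owner lam D i) else 0) + a := by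
    intro i
    have hbig : ∀ v, n ≤ (cls (low l i M) v).card * a →
        1 / ((cls (low l i M) v).card : ℝ) ≤ a / n := by
      intro v hv
      have hc : (0 : ℝ) < (cls (low l i M) v).card := by exact_mod_cast cls_card_pos _ v
      rw [div_le_div_iff₀ hc hn', one_mul, mul_comm]
      exact_mod_cast hv
    have hna : ∑ _v : Fin n, (a : ℝ) / n = a := by
      rw [Finset.sum_const, Finset.card_univ, Fintype.card_fin, nsmul_eq_mul]
      field_simp
    have ha : (0 : ℝ) ≤ a / n := by positivity
    split_ifs with hi
    · rw [← hna]
      unfold total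
      rw [← Finset.sum_add_distrib]
      refine Finset.sum_le_sum fun v _ => ?_
      by_cases hv : (cls (low l i M) v).card * a < n
      · have h1 := hC.one_le_weight hinj howner hkey hlam hl hdead hi.le v hv
        have h2 := div_le_div_of_nonneg_right h1
          (show (0 : ℝ) ≤ (cls (low l i M) v).card by positivity)
        linarith
      · have h1 := hbig v (not_lt.1 hv)
        have h2 := share_nonneg (hA i) (low l i M) v
        unfold share at h2
        linarith
    · rw [zero_add, ← hna]
      exact Finset.sum_le_sum fun v _ => hbig v
        (hC.not_small hinj howner hkey hlam hw hK hLN hl hdead (not_lt.1 hi) v)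
  have hsum : (∑ e ∈ M, (l e : ℝ)) = ∑ i ∈ Finset.range Y, ((M.card : ℝ) - (low l i M).card) := by
    have h1 : ∀ e ∈ M, (l e : ℝ) = ∑ i ∈ Finset.range Y, if l e ≤ i then (0 : ℝ) else 1 := by
      intro e he
      have h2 : l e ≤ Y := by
        rw [← hMY] at he
        exact (Finset.mem_filter.1 he).2
      have h3 : (Finset.range Y).filter (fun i => ¬ l e ≤ i) = Finset.range (l e) := by
        ext i
        simp only [Finset.mem_filter, Finset.mem_range]
        omega
      rw [Finset.sum_ite, Finset.sum_const_zero, zero_add, Finset.sum_const, h3,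
        Finset.card_range, nsmul_eq_mul, mul_one]
    rw [Finset.sum_congr rfl h1, Finset.sum_comm]
    refine Finset.sum_congr rfl fun i _ => ?_
    have h4 := Finset.card_filter_add_card_filter_not (s := M) (fun e => l e ≤ i)
    have h5 : (M.card : ℝ) = (low l i M).card + (M.filter fun e => ¬ l e ≤ i).card := by
      exact_mod_cast h4.symm
    rw [Finset.sum_ite, Finset.sum_const_zero, zero_add, Finset.sum_const, nsmul_eq_mul, mul_one,
      h5]
    ring
  have hle : (∑ e ∈ M, (l e : ℝ)) ≤ ∑ i ∈ Finset.range Y,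
      ((if i < L then total (low l i M) (weight l owner lam D i) else 0) + a) := by
    rw [hsum]
    refine Finset.sum_le_sum fun i _ => ?_
    have h1 := hC.count i
    have h2 : (M.card : ℝ) + 1 = n := by exact_mod_cast hM
    linarith [hsmall i]
  have hpot : (∑ i ∈ Finset.range Y,
      (if i < L then total (low l i M) (weight l owner lam D i) else 0)) / n ≤ K := by
    refine le_trans ?_ hC.pot
    unfold potential
    rw [← Finset.sum_filter, Finset.sum_div]
    refine (Finset.sum_le_sum_of_subset_of_nonneg
      (f := fun i => w i * total (low l i M) (weight l owner lam D i))
      (s := (Finset.range Y).filter (· < L)) (t := Finset.range N) ?_ ?_).trans' ?_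
    · intro i
      simp only [Finset.mem_filter, Finset.mem_range]
      omega
    · exact fun i _ _ => mul_nonneg (hw i) (htot i)
    · refine Finset.sum_le_sum fun i hi => ?_
      rw [hwi i (Finset.mem_filter.1 hi).2]
      exact le_of_eq (by ring)
  rw [Finset.sum_add_distrib, Finset.sum_const, Finset.card_range, nsmul_eq_mul] at hle
  have := div_le_div_of_nonneg_right hle hn'.le
  rw [add_div] at this
  linarith

end

/-- An injective enumeration of the edges that refines the order of the levels. -/
theorem exists_key (l : Edge n → ℕ) : ∃ key : Edge n → ℕ, Function.Injective key ∧
    ∀ e e', l e < l e' → key e < key e' := by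
  set N := Fintype.card (Edge n)
  have hlt : ∀ e : Edge n, (Fintype.equivFin (Edge n) e : ℕ) < N := fun e => Fin.is_lt _
  refine ⟨fun e => l e * N + Fintype.equivFin (Edge n) e, ?_, ?_⟩
  · intro e e' h
    have h : l e * N + (Fintype.equivFin (Edge n) e : ℕ) =
      l e' * N + (Fintype.equivFin (Edge n) e' : ℕ) := h
    have h1 := congrArg (· % N) h
    simp only [Nat.mul_add_mod_self_right] at h1
    rw [Nat.mod_eq_of_lt (hlt e), Nat.mod_eq_of_lt (hlt e')] at h1
    exact (Fintype.equivFin (Edge n)).injective (Fin.ext h1)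
  · intro e e' h
    have h1 : (l e + 1) * N ≤ l e' * N := Nat.mul_le_mul_right N h
    have h2 := hlt e
    simp only
    nlinarith

theorem makerWins_of_goodLevels {b a L Y : ℕ} (hn : 0 < n) (hb : 0 < b) {l : Edge n → ℕ}
    (hl : GoodLevels n b a L Y l) {owner : Edge n → Fin n}
    (howner : ∀ e : Edge n, owner e ∈ (e : Sym2 (Fin n))) {lam : ℝ} (hlam : 0 ≤ lam)
    (hexp : Real.exp (lam * b) ≤ 5 / 4) {c : Edge n → ℝ} (hc : ∀ e, c e ≤ l e / n) {K : ℝ}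
    (hKn : K < n)
    (hK : (∑ v, ∑ i ∈ Finset.range L,
        Real.exp (lam * (2 - (owned l owner ∅ i v).card))) / n +
      n * ∑ v, Real.exp (lam * (2 - (owned l owner ∅ L v).card)) ≤ K) :
    MakerWins b c (K + Y * a / n) := by
  obtain ⟨key, hinj, hkey⟩ := exists_key l
  -- One level is worth `1 / n` of cost. The weight `n > K` at level `L` excludes small components
  -- there.
  set w : ℕ → ℝ := fun i => if i < L then 1 / n else n with hw'
  have hn' : (0 : ℝ) < n := by exact_mod_cast hn
  have hw : ∀ i, 0 ≤ w i := fun i => by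
    simp only [hw']
    split_ifs <;> positivity
  have hwi : ∀ i < L, w i = 1 / n := fun i hi => if_pos hi
  have hwL : w L = n := if_neg (lt_irrefl L)
  have hKL : K < w L := by rwa [hwL]
  have hsingle : ∀ i v, weight l owner lam ∅ i {v} =
      Real.exp (lam * (2 - (owned l owner ∅ i v).card)) := fun i v => by simp [weight]
  have hlow : ∀ i, low l i (∅ : Finset (Edge n)) = ∅ := fun i => by simp [low]
  have hinit : Controlled b l key owner lam (L + 1) w K ∅ ∅ ∅ := by
    refine ⟨by simp, by simp, by simp, by simp, by simp, fun i => ?_, ?_⟩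
    · rw [hlow, total_empty]
      simp
    · refine le_trans (le_of_eq ?_) hK
      unfold potential
      rw [Finset.sum_range_succ, hwL, hlow, total_empty]
      simp only [hsingle, hlow, total_empty]
      congr 1
      rw [Finset.sum_comm, Finset.sum_div]
      refine Finset.sum_congr rfl fun i hi => ?_
      rw [hwi i (Finset.mem_range.1 hi)]
      ring
  have main : ∀ k (M B D : Finset (Edge n)), Controlled b l key owner lam (L + 1) w K M B D →
      M.card + k + 1 = n → MakerCanBuild b c (K + Y * a / n) k M B := by
    intro k
    induction k with
    | zero =>
      intro M B D hC hM
      refine ⟨hC.isTree hn hM, ?_⟩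
      refine le_trans ?_ (hC.sum_le hn hinj howner hkey hlam hw hwi hKL (Nat.lt_succ_self L) hl hM)
      rw [Finset.sum_div]
      exact Finset.sum_le_sum fun e _ => hc e
    | succ k ih =>
      intro M B D hC hM
      obtain ⟨f, hfM, hfB, hf⟩ := hC.step hinj howner hkey hlam hb hexp hw hKL
        (Nat.lt_succ_self L) hl (by omega)
      refine ⟨f, hfM, hfB, fun D' hD' hdisj => ?_⟩
      obtain ⟨D'', hC'⟩ := hf D' hD' (by convert! hdisj)
      convert! ih _ _ D'' hC' (by rw [Finset.card_insert_of_notMem hfM]; omega)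
  exact main (n - 1) ∅ ∅ ∅ hinit (by simp; omega)

end Strategy

/-! ### A balanced assignment of the edges to their ends. -/

section Owner
open scoped Classical

/-- The edge joining two different vertices. -/
def mkEdge {n : ℕ} (u v : Fin n) (h : u ≠ v) : Edge n := ⟨s(u, v), by simpa using h⟩

/-- The edges can be assigned to their ends so that every vertex gets about half of its edges. -/
theorem exists_owner (n : ℕ) : ∃ owner : Edge n → Fin n,
    (∀ e : Edge n, owner e ∈ (e : Sym2 (Fin n))) ∧
    ∀ v, n ≤ 2 * (Finset.univ.filter fun e => owner e = v).card + 2 := by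
  -- The parity of `u + v` decides: `v` owns its edges to larger vertices of its own parity and to
  -- smaller ones of the other parity. The map `f` below enumerates these neighbours.
  let p : Fin n → Fin n → Fin n := fun u v =>
    if ((u : ℕ) + v) % 2 = 0 then min u v else max u v
  have hp : ∀ u v, p u v = p v u := fun u v => by
    simp only [p, add_comm, min_comm, max_comm]
  let o : Sym2 (Fin n) → Fin n := Sym2.lift ⟨p, hp⟩
  refine ⟨fun e => o e, fun e => ?_, fun v => ?_⟩
  · obtain ⟨u, w, h, -⟩ := edge_ends e
    simp only
    rw [h, Sym2.mem_iff]
    change p u w = u ∨ p u w = w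
    simp only [p]
    split_ifs
    · exact min_choice u w
    · exact max_choice u w
  · have hv := v.2
    set m := (n - 1 - v) / 2 with hm
    set f : ℕ → ℕ := fun k => if k < m then v + 2 * k + 2 else v - 1 - 2 * (k - m) with hf
    have hfn : ∀ k < m + (v + 1) / 2, f k < n ∧ f k ≠ v ∧
        ((v < f k ∧ (v + f k) % 2 = 0) ∨ (f k < v ∧ (v + f k) % 2 = 1)) := by
      intro k hk
      simp only [hf]
      split_ifs <;> omega
    have hcard : m + (v + 1) / 2 ≤ (Finset.univ.filter fun e : Edge n => o e = v).card := by
      have hne : ∀ k : Fin (m + ((v : ℕ) + 1) / 2), v ≠ ⟨f k, (hfn k k.2).1⟩ := fun k h =>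
        (hfn k k.2).2.1 (congrArg Fin.val h).symm
      conv_lhs => rw [← Fintype.card_fin (m + ((v : ℕ) + 1) / 2), ← Finset.card_univ]
      refine Finset.card_le_card_of_injOn (fun k => mkEdge v _ (hne k)) ?_ ?_
      · intro k _
        have h1 := (hfn k k.2).2.2
        simp only [Finset.coe_filter, Finset.mem_univ, true_and, Set.mem_ofPred_eq]
        change p v ⟨f k, (hfn k k.2).1⟩ = v
        simp only [p]
        split_ifs with h2
        · refine min_eq_left (Fin.le_def.2 ?_)
          simp only at h2 ⊢
          omega
        · refine max_eq_left (Fin.le_def.2 ?_)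
          simp only at h2 ⊢
          omega
      · intro k _ k' _ h
        have h1 : s(v, (⟨f k, (hfn k k.2).1⟩ : Fin n)) = s(v, ⟨f k', (hfn k' k'.2).1⟩) :=
          congrArg Subtype.val h
        have h2 := congrArg Fin.val (Sym2.congr_right.1 h1)
        have hk := k.2
        have hk' := k'.2
        have h3 : f k = f k' := h2
        simp only [hf] at h3
        apply Fin.ext
        split_ifs at h3 <;> omega
    simp only
    omega

end Owner

/-! ### Numerical estimates for the constants. -/

section Constants

/-- At `1 / 3` the defining function is already at least `log 2`, which amounts to `3 ^ 3 ≤ 2 ^ 5`;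
the intermediate value theorem and uniqueness do the rest. -/
theorem thetaStar_le : thetaStar ≤ 1 / 3 := by
  have hc : Continuous thetaFun := by
    unfold thetaFun
    exact (Real.continuous_mul_log.comp (continuous_const.add continuous_id)).sub
      Real.continuous_mul_log
  have h0 : thetaFun 0 = 0 := by simp [thetaFun]
  have hl : 0 < Real.log 2 := Real.log_pos (by norm_num)
  have h1 : Real.log 2 ≤ thetaFun (1 / 3) := by
    have h2 : 3 * Real.log 3 ≤ 5 * Real.log 2 := by
      have h3 : Real.log (3 ^ 3) ≤ Real.log (2 ^ 5) := Real.log_le_log (by norm_num) (by norm_num)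
      rw [Real.log_pow, Real.log_pow] at h3
      exact_mod_cast h3
    have h4 : Real.log (1 + 1 / 3) = 2 * Real.log 2 - Real.log 3 := by
      rw [show (1 + 1 / 3 : ℝ) = 2 ^ 2 / 3 by norm_num, Real.log_div (by norm_num) (by norm_num),
        Real.log_pow]
      norm_num
    have h5 : Real.log (1 / 3) = - Real.log 3 := by rw [one_div, Real.log_inv]
    unfold thetaFun
    rw [h4, h5]
    linarith
  obtain ⟨x, hx, hxe⟩ : Real.log 2 ∈ thetaFun '' Set.Icc 0 (1 / 3) :=
    intermediate_value_Icc (by norm_num) hc.continuousOn ⟨by rw [h0]; exact hl.le, h1⟩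
  have hx0 : 0 < x := by
    refine lt_of_le_of_ne hx.1 ?_
    rintro rfl
    rw [h0] at hxe
    linarith
  rw [existsUnique_theta.unique ⟨thetaStar_pos, thetaStar_eq⟩ ⟨hx0, hxe⟩]
  exact hx.2

theorem one_le_muB (b : ℕ) : 1 ≤ muB b := (muB_isLeast b).1.1

theorem sixteen_mul_add_four_le (b : ℕ) :
    16 * (b : ℝ) + 4 ≤ 4 * muB b * ((b : ℝ) / thetaStar + b + 1 + 0) := by
  have h1 := one_le_muB b
  have h2 := thetaStar_le
  have h3 := thetaStar_pos
  have hb : (0 : ℝ) ≤ b := by positivity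
  have h4 : 3 * (b : ℝ) ≤ b / thetaStar := by
    rw [le_div_iff₀ h3]
    nlinarith
  have h5 : 4 * (b : ℝ) + 1 ≤ (b : ℝ) / thetaStar + b + 1 + 0 := by linarith
  nlinarith

theorem exp_log_mul_le {b : ℕ} (hb : 0 < b) :
    Real.exp (Real.log (1 + 1 / (5 * b)) * b) ≤ 5 / 4 := by
  have hb' : (0 : ℝ) < b := by exact_mod_cast hb
  have h1 : Real.log (1 + 1 / (5 * b)) ≤ 1 / (5 * b) := by
    have := Real.log_le_sub_one_of_pos (show (0 : ℝ) < 1 + 1 / (5 * b) by positivity)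
    linarith
  have h2 : Real.log (1 + 1 / (5 * b)) * b ≤ 1 / 5 := by
    refine (mul_le_mul_of_nonneg_right h1 hb'.le).trans (le_of_eq ?_)
    field_simp
  have h3 := Real.add_one_le_exp (-(1 / 5))
  rw [Real.exp_neg] at h3
  refine (Real.exp_le_exp.2 h2).trans ?_
  have h4 := Real.exp_pos (1 / 5)
  have h5 : (-(1 / 5) + 1) * Real.exp (1 / 5) ≤ 1 := by
    refine (mul_le_mul_of_nonneg_right h3 h4.le).trans (le_of_eq ?_)
    field_simp
  linarith

end Constants

/-! ### Levels and exponential moments of the random costs. -/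

section Costs
open scoped Classical
open ProbabilityTheory

variable {n : ℕ}

/-- The level of an edge of cost `c e`. -/
noncomputable def level (c : Edge n → ℝ) (e : Edge n) : ℕ := ⌈(n : ℝ) * c e⌉₊

theorem level_le_iff (hn : 0 < n) {c : Edge n → ℝ} {e : Edge n} {i : ℕ} :
    level c e ≤ i ↔ c e ≤ (i : ℝ) / n := by
  rw [level, Nat.ceil_le, le_div_iff₀ (by exact_mod_cast hn), mul_comm]

theorem le_level_div (hn : 0 < n) (c : Edge n → ℝ) (e : Edge n) : c e ≤ (level c e : ℝ) / n :=
  (level_le_iff hn).1 le_rfl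

instance : IsProbabilityMeasure ((volume : Measure ℝ).restrict (Set.Icc 0 1)) :=
  ⟨by simp⟩

instance (n : ℕ) : IsProbabilityMeasure (costLaw n) := by
  unfold costLaw
  infer_instance

theorem uniform_Iic {t : ℝ} (h0 : 0 ≤ t) (h1 : t ≤ 1) :
    ((volume : Measure ℝ).restrict (Set.Icc 0 1)).real (Set.Iic t) = t := by
  rw [measureReal_restrict_apply measurableSet_Iic]
  have : Set.Iic t ∩ Set.Icc 0 1 = Set.Icc (0 : ℝ) t := by
    ext x
    simp only [Set.mem_inter_iff, Set.mem_Iic, Set.mem_Icc]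
    constructor
    · rintro ⟨h2, h3, h4⟩; exact ⟨h3, h2⟩
    · rintro ⟨h2, h3⟩; exact ⟨h3, h2, h3.trans h1⟩
  rw [this, Real.volume_real_Icc_of_le h0, sub_zero]

theorem integral_ite_le {t : ℝ} (h0 : 0 ≤ t) (h1 : t ≤ 1) (r : ℝ) :
    ∫ x, (if x ≤ t then r else 1) ∂((volume : Measure ℝ).restrict (Set.Icc 0 1)) =
      1 - t * (1 - r) := by
  have h2 : (fun x : ℝ => if x ≤ t then r else 1) =
      fun x => 1 - (Set.Iic t).indicator (fun _ => 1 - r) x := by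
    ext x
    by_cases h : x ≤ t <;> simp [Set.indicator, h]
  rw [h2, integral_sub (integrable_const _)
    ((integrable_const _).indicator measurableSet_Iic), integral_indicator_const _ measurableSet_Iic,
    uniform_Iic h0 h1]
  simp

/-- The number of edges of `A` of cost at most `t`. -/
noncomputable def cheap (A : Finset (Edge n)) (t : ℝ) (c : Edge n → ℝ) : ℕ :=
  (A.filter fun e => c e ≤ t).card

theorem pow_cheap_eq_prod (A : Finset (Edge n)) (t r : ℝ) (c : Edge n → ℝ) :
    r ^ cheap A t c = ∏ e, if e ∈ A then (if c e ≤ t then r else 1) else 1 := by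
  rw [← Finset.prod_filter, Finset.filter_mem_eq_inter, Finset.univ_inter, ← Finset.prod_filter,
    Finset.prod_const, cheap]

theorem measurable_pow_cheap (A : Finset (Edge n)) (t r : ℝ) :
    Measurable fun c : Edge n → ℝ => r ^ cheap A t c := by
  simp only [pow_cheap_eq_prod]
  refine Finset.measurable_prod _ fun e _ => ?_
  split_ifs
  · exact Measurable.ite (measurableSet_le (measurable_pi_apply e) measurable_const)
      measurable_const measurable_const
  · exact measurable_const

/-- The generating function of a binomial variable: `r ^ cheap A t c` is a product over independent
edges. -/
theorem integral_pow_cheap (A : Finset (Edge n)) {t : ℝ} (h0 : 0 ≤ t) (h1 : t ≤ 1) (r : ℝ) :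
    ∫ c, r ^ cheap A t c ∂(costLaw n) = (1 - t * (1 - r)) ^ A.card := by
  simp only [pow_cheap_eq_prod]
  rw [costLaw, integral_fintype_prod_eq_prod
    (f := fun (e : Edge n) (x : ℝ) => if e ∈ A then (if x ≤ t then r else 1) else 1)]
  have : ∀ e : Edge n, ∫ x, (if e ∈ A then (if x ≤ t then r else 1) else 1)
      ∂((volume : Measure ℝ).restrict (Set.Icc 0 1)) = if e ∈ A then 1 - t * (1 - r) else 1 := by
    intro e
    split_ifs
    · exact integral_ite_le h0 h1 r
    · simp
  rw [Finset.prod_congr rfl fun e _ => this e, ← Finset.prod_filter, Finset.filter_mem_eq_inter,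
    Finset.univ_inter, Finset.prod_const]

theorem pow_cheap_mem_Icc (A : Finset (Edge n)) (t : ℝ) {r : ℝ} (h0 : 0 ≤ r) (h1 : r ≤ 1)
    (c : Edge n → ℝ) : r ^ cheap A t c ∈ Set.Icc (0 : ℝ) 1 :=
  ⟨pow_nonneg h0 _, pow_le_one₀ h0 h1⟩

theorem integrable_pow_cheap (A : Finset (Edge n)) (t : ℝ) {r : ℝ} (h0 : 0 ≤ r) (h1 : r ≤ 1) :
    Integrable (fun c => r ^ cheap A t c) (costLaw n) :=
  Integrable.of_mem_Icc 0 1 (measurable_pow_cheap A t r).aemeasurable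
    (ae_of_all _ (pow_cheap_mem_Icc A t h0 h1))

theorem integral_pow_cheap_le (A : Finset (Edge n)) {t : ℝ} (h0 : 0 ≤ t) (h1 : t ≤ 1) {r : ℝ}
    (hr0 : 0 ≤ r) (hr : r ≤ 1) {d : ℝ} (hd : d ≤ A.card) :
    ∫ c, r ^ cheap A t c ∂(costLaw n) ≤ Real.exp (-(t * (1 - r) * d)) := by
  rw [integral_pow_cheap A h0 h1]
  have h2 : 0 ≤ t * (1 - r) := mul_nonneg h0 (by linarith)
  have h3 : 0 ≤ 1 - t * (1 - r) := by nlinarith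
  have h4 := Real.add_one_le_exp (-(t * (1 - r)))
  calc (1 - t * (1 - r)) ^ A.card ≤ Real.exp (-(t * (1 - r))) ^ A.card :=
        pow_le_pow_left₀ h3 (by linarith) _
    _ = Real.exp (-(t * (1 - r) * A.card)) := by
        rw [← Real.exp_nat_mul]
        congr 1
        ring
    _ ≤ Real.exp (-(t * (1 - r) * d)) := by
        rw [Real.exp_le_exp, neg_le_neg_iff]
        exact mul_le_mul_of_nonneg_left hd h2

theorem measure_all_cheap (F : Finset (Edge n)) {t : ℝ} (h0 : 0 ≤ t) (h1 : t ≤ 1) :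
    (costLaw n).real {c | ∀ e ∈ F, c e ≤ t} = t ^ F.card := by
  have h2 : {c : Edge n → ℝ | ∀ e ∈ F, c e ≤ t} =
      Set.univ.pi fun e => if e ∈ F then Set.Iic t else Set.univ := by
    ext c
    simp only [Set.mem_ofPred_eq, Set.mem_pi, Set.mem_univ, true_implies]
    refine forall_congr' fun e => ?_
    by_cases h : e ∈ F <;> simp [h]
  rw [h2, costLaw, measureReal_def, Measure.pi_pi, ENNReal.toReal_prod]
  have : ∀ e : Edge n, (((volume : Measure ℝ).restrict (Set.Icc 0 1))
      (if e ∈ F then Set.Iic t else Set.univ)).toReal = if e ∈ F then t else 1 := by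
    intro e
    split_ifs
    · exact uniform_Iic h0 h1
    · simp
  rw [Finset.prod_congr rfl fun e _ => this e, ← Finset.prod_filter, Finset.filter_mem_eq_inter,
    Finset.univ_inter, Finset.prod_const]

theorem indepFun_cheap {A A' : Finset (Edge n)} (h : Disjoint A A') (I : Finset ℕ)
    (t : ℕ → ℝ) (r : ℝ) :
    IndepFun (fun c => ∑ i ∈ I, r ^ cheap A (t i) c) (fun c => ∑ i ∈ I, r ^ cheap A' (t i) c)
      (costLaw n) := by
  have h1 : iIndepFun (fun (e : Edge n) (c : Edge n → ℝ) => c e) (costLaw n) :=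
    iIndepFun_pi (X := fun _ x => x) fun _ => aemeasurable_id
  have h2 := h1.indepFun_finset A A' h fun e => measurable_pi_apply e
  have key : ∀ A : Finset (Edge n), ∃ g : (A → ℝ) → ℝ, Measurable g ∧
      (fun c : Edge n → ℝ => ∑ i ∈ I, r ^ cheap A (t i) c) = g ∘ fun c (e : A) => c e := by
    intro A
    refine ⟨fun y => ∑ i ∈ I, ∏ e : A, if y e ≤ t i then r else 1, ?_, ?_⟩
    · refine Finset.measurable_sum _ fun i _ => Finset.measurable_prod _ fun e _ => ?_
      exact Measurable.ite (measurableSet_le (measurable_pi_apply e) measurable_const)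
        measurable_const measurable_const
    · ext c
      refine Finset.sum_congr rfl fun i _ => ?_
      rw [cheap, ← Finset.prod_const, Finset.prod_filter]
      exact (Finset.prod_coe_sort A fun e => if c e ≤ t i then r else 1).symm
  obtain ⟨g, hg, hgA⟩ := key A
  obtain ⟨g', hg', hgA'⟩ := key A'
  rw [hgA, hgA']
  exact h2.comp hg hg'

end Costs

/-! ### The four unlikely events. -/

section Events
open scoped Classical
open ProbabilityTheory

variable {n : ℕ}

/-- The edges with both ends in `S`. -/
noncomputable def innerEdges (S : Finset (Fin n)) : Finset (Edge n) :=
  Finset.univ.filter fun e => ∀ x ∈ (e : Sym2 (Fin n)), x ∈ S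

theorem card_innerEdges_le (S : Finset (Fin n)) : (innerEdges S).card ≤ S.card ^ 2 := by
  have h1 : (innerEdges S).card ≤ S.sym2.card := by
    refine Finset.card_le_card_of_injOn (fun e => (e : Sym2 (Fin n))) ?_
      (Subtype.val_injective.injOn)
    intro e he
    simp only [innerEdges, Finset.coe_filter, Finset.mem_univ, true_and, Set.mem_ofPred_eq] at he
    exact Finset.mem_coe.2 (Finset.mem_sym2_iff.2 he)
  rw [Finset.card_sym2, Nat.choose_two_right, Nat.add_sub_cancel] at h1
  refine h1.trans (Nat.div_le_of_le_mul ?_)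
  rcases Nat.eq_zero_or_pos S.card with h | h
  · simp [h]
  · nlinarith

/-- With `k ^ k / k! ≤ exp k` for `k = s` and `k = 2 * s`, the factorials cost at most `exp (3 * s)
≤ 24 ^ s`; what remains is `(s * L ^ 2 / (4 * n)) ^ s`, where `s / n < 1 / a`. -/
theorem sparse_term_le {s L a : ℕ} (ha : 0 < a) (hs : s * a < n) :
    (n.choose s : ℝ) * (((s ^ 2).choose (2 * s) : ℝ) * ((L : ℝ) / n) ^ (2 * s)) ≤
      (6 * (L : ℝ) ^ 2 / a) ^ s := by
  have hn : (0 : ℝ) < n := by exact_mod_cast (Nat.zero_le _).trans_lt hs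
  have ha' : (0 : ℝ) < a := by exact_mod_cast ha
  have h1 : (n.choose s : ℝ) ≤ (n : ℝ) ^ s / (s.factorial : ℝ) := Nat.choose_le_pow_div s n
  have h2 : ((s ^ 2).choose (2 * s) : ℝ) ≤ ((s ^ 2 : ℕ) : ℝ) ^ (2 * s) / ((2 * s).factorial : ℝ) :=
    Nat.choose_le_pow_div (2 * s) (s ^ 2)
  have h3 := Real.pow_div_factorial_le_exp (s : ℝ) (by positivity) s
  have h4 := Real.pow_div_factorial_le_exp (2 * s : ℝ) (by positivity) (2 * s)
  have h5 : Real.exp (s : ℝ) * Real.exp (2 * s : ℝ) ≤ 24 ^ s := by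
    rw [← Real.exp_add, show (s : ℝ) + 2 * s = s * 3 by ring, Real.exp_nat_mul]
    refine pow_le_pow_left₀ (Real.exp_pos _).le ?_ s
    have h6 : Real.exp 3 = Real.exp 1 ^ 3 := by rw [← Real.exp_nat_mul]; norm_num
    rw [h6]
    have h7 := Real.exp_one_lt_d9
    calc Real.exp 1 ^ 3 ≤ 2.8 ^ 3 :=
          pow_le_pow_left₀ (Real.exp_pos _).le (by linarith) 3
      _ ≤ 24 := by norm_num
  have h8 : (s : ℝ) * (L : ℝ) ^ 2 / (4 * n) ≤ (L : ℝ) ^ 2 / (4 * a) := by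
    rw [div_le_div_iff₀ (by positivity) (by positivity)]
    have h9 : (s : ℝ) * a ≤ n := by exact_mod_cast hs.le
    nlinarith [mul_le_mul_of_nonneg_left h9 (show (0 : ℝ) ≤ 4 * (L : ℝ) ^ 2 by positivity)]
  calc (n.choose s : ℝ) * (((s ^ 2).choose (2 * s) : ℝ) * ((L : ℝ) / n) ^ (2 * s))
      ≤ ((n : ℝ) ^ s / (s.factorial : ℝ)) *
        ((((s ^ 2 : ℕ) : ℝ) ^ (2 * s) / ((2 * s).factorial : ℝ)) * ((L : ℝ) / n) ^ (2 * s)) := by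
        gcongr
    _ = ((s : ℝ) ^ s / s.factorial * ((2 * s : ℝ) ^ (2 * s) / (2 * s).factorial)) *
        ((s : ℝ) * (L : ℝ) ^ 2 / (4 * n)) ^ s := by
        push_cast
        rw [pow_mul (s ^ 2 : ℝ) 2 s, pow_mul ((L : ℝ) / n) 2 s, pow_mul (2 * s : ℝ) 2 s]
        have h10 : (n : ℝ) ^ s * (((s : ℝ) ^ 2) ^ 2) ^ s * (((L : ℝ) / n) ^ 2) ^ s =
            (s : ℝ) ^ s * ((2 * s : ℝ) ^ 2) ^ s * ((s : ℝ) * (L : ℝ) ^ 2 / (4 * n)) ^ s := by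
          simp only [← mul_pow]
          congr 1
          field_simp
          ring
        calc _ = (n : ℝ) ^ s * (((s : ℝ) ^ 2) ^ 2) ^ s * (((L : ℝ) / n) ^ 2) ^ s /
              (s.factorial * (2 * s).factorial) := by
              field_simp
          _ = _ := by
              rw [h10]
              field_simp
    _ ≤ (Real.exp (s : ℝ) * Real.exp (2 * s : ℝ)) * ((L : ℝ) ^ 2 / (4 * a)) ^ s := by
        gcongr
    _ ≤ 24 ^ s * ((L : ℝ) ^ 2 / (4 * a)) ^ s := by gcongr
    _ = (6 * (L : ℝ) ^ 2 / a) ^ s := by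
        rw [← mul_pow]
        congr 1
        field_simp
        ring

theorem sum_geom_le {x : ℝ} (h0 : 0 ≤ x) (h1 : x < 1) (N : ℕ) :
    ∑ i ∈ Finset.range N, x ^ i ≤ 1 / (1 - x) := by
  rw [one_div, ← tsum_geometric_of_lt_one h0 h1]
  exact (summable_geometric_of_lt_one h0 h1).sum_le_tsum _ fun i _ => pow_nonneg h0 i

/-- A union bound over the sets `S` and over the choices of `2 * S.card` cheap edges inside `S`,
summed as a geometric series of ratio at most `1 / 2`. -/
theorem measure_not_sparse_le {a L : ℕ} (hn : 0 < n) (ha : 0 < a) (hL : L ≤ n)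
    (hLa : 12 * (L : ℝ) ^ 2 ≤ a) :
    (costLaw n).real {c | ∃ S : Finset (Fin n), S.card * a < n ∧ 2 * S.card <
      (Finset.univ.filter fun e : Edge n =>
        (∀ x ∈ (e : Sym2 (Fin n)), x ∈ S) ∧ level c e ≤ L).card} ≤ 12 * (L : ℝ) ^ 2 / a := by
  have hn' : (0 : ℝ) < n := by exact_mod_cast hn
  have ha' : (0 : ℝ) < a := by exact_mod_cast ha
  have hL0 : (0 : ℝ) ≤ (L : ℝ) / n := by positivity
  have hL1 : (L : ℝ) / n ≤ 1 := by
    rw [div_le_one hn']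
    exact_mod_cast hL
  set G : Finset (Fin n) → Set (Edge n → ℝ) := fun S =>
    ⋃ F ∈ (innerEdges S).powersetCard (2 * S.card), {c | ∀ e ∈ F, c e ≤ (L : ℝ) / n} with hG
  set q : ℕ → ℝ := fun s => if 0 < s ∧ s * a < n then
    ((s ^ 2).choose (2 * s) : ℝ) * ((L : ℝ) / n) ^ (2 * s) else 0 with hq
  have hGle : ∀ S : Finset (Fin n), (costLaw n).real (G S) ≤
      ((S.card ^ 2).choose (2 * S.card) : ℝ) * ((L : ℝ) / n) ^ (2 * S.card) := by
    intro S
    refine (measureReal_biUnion_finset_le _ _).trans ?_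
    rw [Finset.sum_congr rfl fun F hF => by
      rw [measure_all_cheap F hL0 hL1, (Finset.mem_powersetCard.1 hF).2], Finset.sum_const,
      nsmul_eq_mul, Finset.card_powersetCard]
    refine mul_le_mul_of_nonneg_right ?_ (by positivity)
    exact_mod_cast Nat.choose_le_choose _ (card_innerEdges_le S)
  have hsub : {c | ∃ S : Finset (Fin n), S.card * a < n ∧ 2 * S.card <
      (Finset.univ.filter fun e : Edge n =>
        (∀ x ∈ (e : Sym2 (Fin n)), x ∈ S) ∧ level c e ≤ L).card} ⊆
      ⋃ S ∈ (Finset.univ : Finset (Fin n)).powerset.filter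
        (fun S => 0 < S.card ∧ S.card * a < n), G S := by
    rintro c ⟨S, hS, hc⟩
    have hpos : 0 < S.card := by
      by_contra h0
      obtain ⟨e, he⟩ := Finset.card_pos.1 ((Nat.zero_le _).trans_lt hc)
      rw [Finset.mem_filter] at he
      obtain ⟨u, w, huw, -⟩ := edge_ends (e : Edge n)
      have hu := he.2.1 u (by rw [huw]; exact Sym2.mem_mk_left u w)
      exact h0 (Finset.card_pos.2 ⟨u, hu⟩)
    obtain ⟨F, hF, hFc⟩ := Finset.exists_subset_card_eq hc.le
    refine Set.mem_iUnion₂.2 ⟨S, by simpa using ⟨Finset.card_pos.1 hpos, hS⟩, ?_⟩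
    refine Set.mem_iUnion₂.2 ⟨F, Finset.mem_powersetCard.2 ⟨fun e he => ?_, hFc⟩, fun e he => ?_⟩
    · have := (Finset.mem_filter.1 (hF he)).2.1
      simpa [innerEdges] using this
    · exact (level_le_iff hn).1 (Finset.mem_filter.1 (hF he)).2.2
  have hx0 : 0 ≤ 6 * (L : ℝ) ^ 2 / a := by positivity
  have hx1 : 6 * (L : ℝ) ^ 2 / a ≤ 1 / 2 := by
    rw [div_le_iff₀ ha']
    linarith
  calc _ ≤ (costLaw n).real (⋃ S ∈ (Finset.univ : Finset (Fin n)).powerset.filter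
        (fun S => 0 < S.card ∧ S.card * a < n), G S) := measureReal_mono hsub (measure_ne_top _ _)
    _ ≤ ∑ S ∈ (Finset.univ : Finset (Fin n)).powerset.filter
        (fun S => 0 < S.card ∧ S.card * a < n), (costLaw n).real (G S) :=
        measureReal_biUnion_finset_le _ _
    _ ≤ ∑ S ∈ (Finset.univ : Finset (Fin n)).powerset, q S.card := by
        rw [Finset.sum_filter]
        refine Finset.sum_le_sum fun S _ => ?_
        simp only [hq]
        split_ifs
        · exact hGle S
        · exact le_rfl
    _ = ∑ s ∈ Finset.range (n + 1), (n.choose s : ℝ) * q s := by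
        rw [Finset.sum_powerset_apply_card, Finset.card_univ, Fintype.card_fin]
        simp only [nsmul_eq_mul]
    _ ≤ ∑ s ∈ Finset.range n, (6 * (L : ℝ) ^ 2 / a) ^ (s + 1) := by
        rw [Finset.sum_range_succ']
        have h0 : q 0 = 0 := by simp [hq]
        rw [h0, mul_zero, add_zero]
        refine Finset.sum_le_sum fun s _ => ?_
        simp only [hq]
        split_ifs with h
        · exact sparse_term_le ha h.2
        · rw [mul_zero]
          positivity
    _ = 6 * (L : ℝ) ^ 2 / a * ∑ s ∈ Finset.range n, (6 * (L : ℝ) ^ 2 / a) ^ s := by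
        rw [Finset.mul_sum]
        exact Finset.sum_congr rfl fun s _ => pow_succ' _ _
    _ ≤ 6 * (L : ℝ) ^ 2 / a * 2 := by
        refine mul_le_mul_of_nonneg_left ?_ hx0
        refine (sum_geom_le hx0 (by linarith) n).trans ?_
        rw [div_le_iff₀ (by linarith)]
        linarith
    _ = 12 * (L : ℝ) ^ 2 / a := by ring

/-- The edges with exactly one end in `S`. -/
noncomputable def boundary (S : Finset (Fin n)) : Finset (Edge n) :=
  Finset.univ.filter fun e => Crosses S e

theorem le_card_boundary (S : Finset (Fin n)) : S.card * (n - S.card) ≤ (boundary S).card := by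
  have hne : ∀ p : ↥(S ×ˢ Sᶜ), p.1.1 ≠ p.1.2 := by
    rintro ⟨⟨u, w⟩, h⟩ huw
    rw [Finset.mem_product, Finset.mem_compl] at h
    simp only at huw h
    exact h.2 (huw ▸ h.1)
  have h1 : (S ×ˢ Sᶜ).attach.card ≤ (boundary S).card := by
    refine Finset.card_le_card_of_injOn (fun p => mkEdge p.1.1 p.1.2 (hne p)) ?_ ?_
    · rintro ⟨⟨u, w⟩, h⟩ -
      rw [Finset.mem_product, Finset.mem_compl] at h
      simp only [boundary, Finset.coe_filter, Finset.mem_univ, true_and, Set.mem_ofPred_eq]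
      exact ⟨u, w, rfl, h.1, h.2⟩
    · rintro ⟨⟨u, w⟩, h⟩ - ⟨⟨u', w'⟩, h'⟩ - heq
      have h2 : s(u, w) = s(u', w') := congrArg Subtype.val heq
      rw [Finset.mem_product, Finset.mem_compl] at h h'
      simp only at h h'
      rw [Sym2.eq_iff] at h2
      rcases h2 with ⟨rfl, rfl⟩ | ⟨rfl, rfl⟩
      · rfl
      · exact absurd h.1 h'.2
  rwa [Finset.card_attach, Finset.card_product, Finset.card_compl, Fintype.card_fin] at h1

/-- Markov's inequality for `(1 / 2) ^ cheap` and a union bound over at most `2 ^ n` sets. A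
boundary has at least `S.card * n / 2` edges, so its expected number of cheap edges is at least `4 *
(b + 1) * n`; the constant `8` in `hY` serves this. -/
theorem measure_not_expand_le {a b Y : ℕ} (hn : 0 < n) (hY : 8 * (b + 1) * a ≤ Y) (hYn : Y ≤ n) :
    (costLaw n).real {c | ∃ S : Finset (Fin n), n ≤ S.card * a ∧ 2 * S.card ≤ n ∧
      (Finset.univ.filter fun e : Edge n => Crosses S e ∧ level c e ≤ Y).card ≤ b * n} ≤
      (1 / 2) ^ n := by
  have hn' : (0 : ℝ) < n := by exact_mod_cast hn
  have hY0 : (0 : ℝ) ≤ (Y : ℝ) / n := by positivity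
  have hY1 : (Y : ℝ) / n ≤ 1 := by
    rw [div_le_one hn']
    exact_mod_cast hYn
  set T := (Finset.univ : Finset (Fin n)).powerset.filter
    (fun S => n ≤ S.card * a ∧ 2 * S.card ≤ n) with hT
  set G : Finset (Fin n) → Set (Edge n → ℝ) := fun S =>
    {c | (1 / 2 : ℝ) ^ (b * n) ≤ (1 / 2 : ℝ) ^ cheap (boundary S) ((Y : ℝ) / n) c} with hG
  have hsub : {c | ∃ S : Finset (Fin n), n ≤ S.card * a ∧ 2 * S.card ≤ n ∧
      (Finset.univ.filter fun e : Edge n => Crosses S e ∧ level c e ≤ Y).card ≤ b * n} ⊆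
      ⋃ S ∈ T, G S := by
    rintro c ⟨S, h1, h2, h3⟩
    refine Set.mem_iUnion₂.2 ⟨S, by simpa [hT] using ⟨h1, h2⟩, ?_⟩
    refine pow_le_pow_of_le_one (a := (1 / 2 : ℝ)) (by norm_num) (by norm_num)
      (le_trans (le_of_eq ?_) h3)
    unfold cheap boundary
    rw [Finset.filter_filter]
    simp only [level_le_iff hn]
  have hGle : ∀ S ∈ T, (costLaw n).real (G S) ≤
      2 ^ (b * n) * Real.exp (-(2 * ((b : ℝ) + 1) * n)) := by
    intro S hS
    rw [hT, Finset.mem_filter] at hS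
    obtain ⟨-, h1, h2⟩ := hS
    have h3 := mul_meas_ge_le_integral_of_nonneg
      (ae_of_all (costLaw n) fun c => (pow_cheap_mem_Icc (boundary S) ((Y : ℝ) / n)
        (show (0 : ℝ) ≤ 1 / 2 by norm_num) (by norm_num) c).1)
      (integrable_pow_cheap (boundary S) ((Y : ℝ) / n) (by norm_num) (by norm_num))
      ((1 / 2 : ℝ) ^ (b * n))
    have h4 : (S.card : ℝ) * n / 2 ≤ (boundary S).card := by
      have h5 : ((S.card * (n - S.card) : ℕ) : ℝ) ≤ (boundary S).card := by
        exact_mod_cast le_card_boundary S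
      rw [Nat.cast_mul, Nat.cast_sub (by omega)] at h5
      have h6 : 2 * (S.card : ℝ) ≤ n := by exact_mod_cast h2
      have h7 : (0 : ℝ) ≤ S.card := by positivity
      nlinarith
    have h5 := integral_pow_cheap_le (boundary S) hY0 hY1 (show (0 : ℝ) ≤ 1 / 2 by norm_num)
      (by norm_num) h4
    have h6 : 2 * ((b : ℝ) + 1) * n ≤ (Y : ℝ) / n * (1 - 1 / 2) * ((S.card : ℝ) * n / 2) := by
      have h7 : (Y : ℝ) / n * (1 - 1 / 2) * ((S.card : ℝ) * n / 2) = Y * S.card / 4 := by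
        field_simp
        ring
      rw [h7]
      have h8 : 8 * ((b : ℝ) + 1) * a ≤ Y := by exact_mod_cast hY
      have h9 : (n : ℝ) ≤ S.card * a := by exact_mod_cast h1
      have h10 := mul_le_mul_of_nonneg_right h8 (show (0 : ℝ) ≤ S.card by positivity)
      have h11 := mul_le_mul_of_nonneg_left h9 (show (0 : ℝ) ≤ 8 * ((b : ℝ) + 1) by positivity)
      linarith
    have h7 : (1 / 2 : ℝ) ^ (b * n) * (costLaw n).real (G S) ≤
        Real.exp (-(2 * ((b : ℝ) + 1) * n)) :=
      h3.trans (h5.trans (Real.exp_le_exp.2 (neg_le_neg h6)))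
    have h8 : (2 : ℝ) ^ (b * n) * (1 / 2 : ℝ) ^ (b * n) = 1 := by
      rw [← mul_pow]
      norm_num
    calc (costLaw n).real (G S) =
          2 ^ (b * n) * ((1 / 2 : ℝ) ^ (b * n) * (costLaw n).real (G S)) := by
          rw [← mul_assoc, h8, one_mul]
      _ ≤ _ := mul_le_mul_of_nonneg_left h7 (by positivity)
  have hexp : 2 * Real.exp (-2) ≤ 1 / 2 := by
    have h1 := Real.add_one_le_exp (1 : ℝ)
    have h2 : Real.exp 2 = Real.exp 1 * Real.exp 1 := by rw [← Real.exp_add]; norm_num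
    rw [Real.exp_neg, ← div_eq_mul_inv, div_le_iff₀ (Real.exp_pos _)]
    nlinarith
  calc _ ≤ (costLaw n).real (⋃ S ∈ T, G S) := measureReal_mono hsub (measure_ne_top _ _)
    _ ≤ ∑ S ∈ T, (costLaw n).real (G S) := measureReal_biUnion_finset_le _ _
    _ ≤ ∑ S ∈ T, 2 ^ (b * n) * Real.exp (-(2 * ((b : ℝ) + 1) * n)) := Finset.sum_le_sum hGle
    _ ≤ 2 ^ n * (2 ^ (b * n) * Real.exp (-(2 * ((b : ℝ) + 1) * n))) := by
        rw [Finset.sum_const, nsmul_eq_mul]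
        refine mul_le_mul_of_nonneg_right ?_ (by positivity)
        have h1 : T.card ≤ 2 ^ n := by
          refine (Finset.card_filter_le _ _).trans ?_
          rw [Finset.card_powerset, Finset.card_univ, Fintype.card_fin]
        exact_mod_cast h1
    _ = (2 * Real.exp (-2)) ^ ((b + 1) * n) := by
        rw [mul_pow, ← Real.exp_nat_mul, ← mul_assoc, ← pow_add]
        push_cast
        congr 2 <;> ring
    _ ≤ (1 / 2) ^ ((b + 1) * n) := pow_le_pow_left₀ (by positivity) hexp _
    _ ≤ (1 / 2) ^ n :=
        pow_le_pow_of_le_one (by norm_num) (by norm_num) (Nat.le_mul_of_pos_left n (by omega))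

/-- Disjoint edge sets make the summands `X v` independent. They lie in `[0, L]`, so each variance
is at most `L ^ 2 / 4` and Chebyshev applies with deviation `n / 4`. The mean of `X v` is at most a
geometric series of ratio `exp (-κ)`. -/
theorem measure_sum_pow_cheap_ge_le {O : Fin n → Finset (Edge n)}
    (hO : ∀ u v, u ≠ v → Disjoint (O u) (O v)) (hn : 2 < n)
    (hcard : ∀ v, ((n : ℝ) - 2) / 2 ≤ (O v).card) {L : ℕ} (hL : L ≤ n) {r κ : ℝ} (hr0 : 0 ≤ r)
    (hr : r < 1) (hκ : κ = (1 - r) * (n - 2) / (2 * n)) :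
    (costLaw n).real {c | n * (1 + 1 / κ) + n / 4 ≤
      ∑ v, ∑ i ∈ Finset.range L, r ^ cheap (O v) ((i : ℝ) / n) c} ≤ 4 * (L : ℝ) ^ 2 / n := by
  have hn' : (2 : ℝ) < n := by exact_mod_cast hn
  have hκ0 : 0 < κ := by
    rw [hκ]
    exact div_pos (mul_pos (by linarith) (by linarith)) (by linarith)
  set X : Fin n → (Edge n → ℝ) → ℝ := fun v c =>
    ∑ i ∈ Finset.range L, r ^ cheap (O v) ((i : ℝ) / n) c with hX
  have hXm : ∀ v, Measurable (X v) := fun v =>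
    Finset.measurable_sum _ fun i _ => measurable_pow_cheap _ _ _
  have hXI : ∀ v c, X v c ∈ Set.Icc (0 : ℝ) L := by
    intro v c
    have h1 := fun i : ℕ => pow_cheap_mem_Icc (O v) ((i : ℝ) / n) hr0 hr.le c
    refine ⟨Finset.sum_nonneg fun i _ => (h1 i).1, ?_⟩
    calc X v c ≤ ∑ i ∈ Finset.range L, (1 : ℝ) := Finset.sum_le_sum fun i _ => (h1 i).2
      _ = L := by simp
  have hXL : ∀ v, MemLp (X v) 2 (costLaw n) := fun v =>
    memLp_of_bounded (ae_of_all _ (hXI v)) (hXm v).aestronglyMeasurable 2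
  have hvar : Var[∑ v, X v; costLaw n] ≤ n * ((L : ℝ) / 2) ^ 2 := by
    rw [IndepFun.variance_sum (fun v _ => hXL v) fun u _ v _ huv =>
      indepFun_cheap (hO u v huv) (Finset.range L) (fun i => (i : ℝ) / n) r]
    calc ∑ v, Var[X v; costLaw n] ≤ ∑ _v : Fin n, ((L : ℝ) / 2) ^ 2 := by
          refine Finset.sum_le_sum fun v _ => ?_
          have := variance_le_sq_of_bounded (ae_of_all (costLaw n) (hXI v)) (hXm v).aemeasurable
          rwa [sub_zero] at this
      _ = n * ((L : ℝ) / 2) ^ 2 := by simp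
  have hmean : ∫ c, (∑ v, X v) c ∂(costLaw n) ≤ n * (1 + 1 / κ) := by
    simp only [Finset.sum_apply]
    rw [integral_finsetSum _ fun v _ => (hXL v).integrable (by norm_num)]
    have h1 : ∀ v, ∫ c, X v c ∂(costLaw n) ≤ 1 + 1 / κ := by
      intro v
      simp only [hX]
      rw [integral_finsetSum _ fun i _ => integrable_pow_cheap _ _ hr0 hr.le]
      have hy1 : Real.exp (-κ) < 1 := by
        rw [Real.exp_lt_one_iff]
        linarith
      calc _ ≤ ∑ i ∈ Finset.range L, Real.exp (-κ) ^ i := by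
            refine Finset.sum_le_sum fun i hi => ?_
            have h2 : (i : ℝ) / n ≤ 1 := by
              rw [div_le_one (by linarith)]
              exact_mod_cast ((Finset.mem_range.1 hi).le.trans hL)
            refine (integral_pow_cheap_le (O v) (by positivity) h2 hr0 hr.le (hcard v)).trans
              (le_of_eq ?_)
            rw [← Real.exp_nat_mul, hκ]
            congr 1
            field_simp
        _ ≤ 1 / (1 - Real.exp (-κ)) := sum_geom_le (Real.exp_pos _).le hy1 L
        _ ≤ 1 + 1 / κ := by
            rw [div_le_iff₀ (by linarith)]
            have h2 := Real.add_one_le_exp κ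
            have h3 : Real.exp (-κ) ≤ 1 / (1 + κ) := by
              rw [Real.exp_neg, ← one_div]
              exact one_div_le_one_div_of_le (by linarith) (by linarith)
            have h4 : (1 + 1 / κ) * (1 - 1 / (1 + κ)) = 1 := by
              field_simp
              ring
            have h5 : 0 < 1 + 1 / κ := by positivity
            nlinarith
    calc _ ≤ ∑ _v : Fin n, (1 + 1 / κ) := Finset.sum_le_sum fun v _ => h1 v
      _ = n * (1 + 1 / κ) := by
        rw [Finset.sum_const, Finset.card_univ, Fintype.card_fin, nsmul_eq_mul]
  have hcheb := meas_ge_le_variance_div_sq (memLp_finsetSum' Finset.univ fun v _ => hXL v)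
    (show (0 : ℝ) < n / 4 by linarith)
  have h1 : (costLaw n).real {c | (n : ℝ) / 4 ≤ |(∑ v, X v) c - ∫ c, (∑ v, X v) c ∂(costLaw n)|} ≤
      Var[∑ v, X v; costLaw n] / ((n : ℝ) / 4) ^ 2 := by
    rw [measureReal_def]
    refine ENNReal.toReal_le_of_le_ofReal (div_nonneg (variance_nonneg _ _) (by positivity)) hcheb
  calc _ ≤ (costLaw n).real
        {c | (n : ℝ) / 4 ≤ |(∑ v, X v) c - ∫ c, (∑ v, X v) c ∂(costLaw n)|} := by
        refine measureReal_mono fun c hc => ?_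
        have h2 : n * (1 + 1 / κ) + n / 4 ≤ (∑ v, X v) c := by
          rw [Finset.sum_apply]
          exact hc
        rw [Set.mem_ofPred_eq]
        refine le_trans ?_ (le_abs_self _)
        linarith
    _ ≤ Var[∑ v, X v; costLaw n] / ((n : ℝ) / 4) ^ 2 := h1
    _ ≤ n * ((L : ℝ) / 2) ^ 2 / ((n : ℝ) / 4) ^ 2 :=
        div_le_div_of_nonneg_right hvar (by positivity)
    _ = 4 * (L : ℝ) ^ 2 / n := by
        field_simp
        norm_num

/-- Markov's inequality: each of the `n` terms has mean at most `exp (-(κ * L))`. -/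
theorem measure_pow_cheap_ge_le {O : Fin n → Finset (Edge n)} (hn : 2 < n)
    (hcard : ∀ v, ((n : ℝ) - 2) / 2 ≤ (O v).card) {L : ℕ} (hL : L ≤ n) {r κ : ℝ} (hr0 : 0 ≤ r)
    (hr : r < 1) (hκ : κ = (1 - r) * (n - 2) / (2 * n)) :
    (costLaw n).real {c | 1 / 8 ≤ n * ∑ v, r ^ cheap (O v) ((L : ℝ) / n) c} ≤
      8 * (n : ℝ) ^ 2 * Real.exp (-(κ * L)) := by
  have hn' : (2 : ℝ) < n := by exact_mod_cast hn
  have hint : ∀ v, Integrable (fun c => r ^ cheap (O v) ((L : ℝ) / n) c) (costLaw n) := fun v =>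
    integrable_pow_cheap _ _ hr0 hr.le
  have h1 := mul_meas_ge_le_integral_of_nonneg (μ := costLaw n)
    (f := fun c => n * ∑ v, r ^ cheap (O v) ((L : ℝ) / n) c)
    (ae_of_all _ fun c => mul_nonneg (by linarith) (Finset.sum_nonneg fun v _ =>
      (pow_cheap_mem_Icc (O v) ((L : ℝ) / n) hr0 hr.le c).1))
    ((integrable_finsetSum _ fun v _ => hint v).const_mul _) (1 / 8)
  have h2 : ∫ c, n * ∑ v, r ^ cheap (O v) ((L : ℝ) / n) c ∂(costLaw n) ≤
      (n : ℝ) ^ 2 * Real.exp (-(κ * L)) := by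
    rw [integral_const_mul, integral_finsetSum _ fun v _ => hint v, sq, mul_assoc]
    refine mul_le_mul_of_nonneg_left ?_ (by linarith)
    calc _ ≤ ∑ _v : Fin n, Real.exp (-(κ * L)) := by
          refine Finset.sum_le_sum fun v _ => ?_
          have h2 : (L : ℝ) / n ≤ 1 := by
            rw [div_le_one (by linarith)]
            exact_mod_cast hL
          refine (integral_pow_cheap_le (O v) (by positivity) h2 hr0 hr.le (hcard v)).trans
            (le_of_eq ?_)
          rw [hκ]
          congr 1
          field_simp
      _ = n * Real.exp (-(κ * L)) := by simp
  linarith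

end Events

/-! ### The choice of the parameters and the limit. -/

section Main

theorem MakerCanBuild.mono {n b : ℕ} {c : Edge n → ℝ} {K K' : ℝ} (h : K ≤ K') :
    ∀ {k : ℕ} {M B : Finset (Edge n)}, MakerCanBuild b c K k M B → MakerCanBuild b c K' k M B := by
  intro k
  induction k with
  | zero => exact fun ⟨h1, h2⟩ => ⟨h1, h2.trans h⟩
  | succ k ih =>
    rintro M B ⟨e, h1, h2, h3⟩
    exact ⟨e, h1, h2, fun D hD hd => ih (h3 D hD hd)⟩

theorem card_owned_eq_cheap {n : ℕ} (hn : 0 < n) (owner : Edge n → Fin n) (c : Edge n → ℝ) (i : ℕ)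
    (v : Fin n) : (owned (level c) owner ∅ i v).card =
      cheap (Finset.univ.filter fun e => owner e = v) ((i : ℝ) / n) c := by
  classical
  unfold owned cheap
  rw [Finset.filter_filter]
  refine congrArg Finset.card (Finset.filter_congr fun e _ => ?_)
  rw [level_le_iff hn]
  simp

/-- With `lam = log z` and `r = 1 / z`, the initial weight of a vertex is `z ^ 2 * r ^ k`, where `k`
counts its cheap owned edges. The potential gets `16 * b + 15 / 4` of the final bound, and the large
components the remaining `1 / 4`. -/
theorem makerWins_of_cheap_lt {n b a L Y : ℕ} (hb : 0 < b)
    (hn : 16 * (5 * b + 1) + 2 ≤ n) (hYn : 4 * Y * a ≤ n) {κ r : ℝ}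
    (hκ : κ = 1 / (5 * b + 1) * (n - 2) / (2 * n)) (hr : r = (1 + 1 / (5 * (b : ℝ)))⁻¹)
    {owner : Edge n → Fin n} (howner : ∀ e : Edge n, owner e ∈ (e : Sym2 (Fin n)))
    {c : Edge n → ℝ} (hgood : GoodLevels n b a L Y (level c))
    (h3 : ∑ v, ∑ i ∈ Finset.range L,
      r ^ cheap (Finset.univ.filter fun e => owner e = v) ((i : ℝ) / n) c <
        n * (1 + 1 / κ) + n / 4)
    (h4 : n * ∑ v, r ^ cheap (Finset.univ.filter fun e => owner e = v) ((L : ℝ) / n) c < 1 / 8) :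
    MakerWins b c (16 * b + 4) := by
  have hn0 : 0 < n := by omega
  have hb' : (1 : ℝ) ≤ b := by exact_mod_cast hb
  have hnR : 16 * (5 * (b : ℝ) + 1) + 2 ≤ n := by exact_mod_cast hn
  have hnpos : (0 : ℝ) < n := by exact_mod_cast hn0
  obtain ⟨z, hz⟩ : ∃ z : ℝ, z = 1 + 1 / (5 * b) := ⟨_, rfl⟩
  have hz1 : 1 < z := by
    have : 0 < 1 / (5 * (b : ℝ)) := by positivity
    linarith
  have hz2 : z ^ 2 ≤ 1.44 := by
    have h1 : 1 / (5 * (b : ℝ)) ≤ 1 / 5 := one_div_le_one_div_of_le (by norm_num) (by linarith)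
    have h2 : z ≤ 1.2 := by rw [hz]; linarith
    nlinarith
  rw [← hz] at hr
  have hr0 : 0 ≤ r := hr ▸ inv_nonneg.2 (by linarith)
  -- The excess over `2 * (5 * b + 1)` is `4 * (5 * b + 1) / (n - 2)`, hence the lower bound on `n`.
  have hinvκ : 1 / κ ≤ 2 * (5 * b + 1) + 1 / 4 := by
    have h2 : 1 / κ = 2 * n * (5 * b + 1) / (n - 2) := by
      have : (n : ℝ) - 2 ≠ 0 := by linarith
      rw [hκ]
      field_simp
    rw [h2, div_le_iff₀ (by linarith)]
    nlinarith
  have hexp : ∀ k : ℕ, Real.exp (Real.log z * (2 - k)) = z ^ 2 * r ^ k := by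
    intro k
    rw [show Real.log z * (2 - k) = (2 : ℕ) * Real.log z - k * Real.log z by push_cast; ring,
      Real.exp_sub, Real.exp_nat_mul, Real.exp_nat_mul, Real.exp_log (by linarith), hr, inv_pow,
      div_eq_mul_inv]
  have hsum : (∑ v, ∑ i ∈ Finset.range L,
      Real.exp (Real.log z * (2 - (owned (level c) owner ∅ i v).card))) / n +
      n * ∑ v, Real.exp (Real.log z * (2 - (owned (level c) owner ∅ L v).card)) ≤
      16 * b + 15 / 4 := by
    simp only [hexp, card_owned_eq_cheap hn0, ← Finset.mul_sum]
    generalize (∑ v, r ^ cheap (Finset.univ.filter fun e => owner e = v) ((L : ℝ) / n) c) = R at h4 ⊢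
    have h6 : 0 ≤ ∑ v, ∑ i ∈ Finset.range L,
        r ^ cheap (Finset.univ.filter fun e => owner e = v) ((i : ℝ) / n) c :=
      Finset.sum_nonneg fun v _ => Finset.sum_nonneg fun i _ => pow_nonneg hr0 _
    generalize (∑ v, ∑ i ∈ Finset.range L,
      r ^ cheap (Finset.univ.filter fun e => owner e = v) ((i : ℝ) / n) c) = S at h3 h6 ⊢
    have h5 : S / n ≤ 1 + 1 / κ + 1 / 4 := by
      rw [div_le_iff₀ hnpos]
      linarith
    calc _ = z ^ 2 * (S / n + n * R) := by ring
      _ ≤ z ^ 2 * (1 + (2 * (5 * b + 1) + 1 / 4) + 1 / 4 + 1 / 8) :=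
          mul_le_mul_of_nonneg_left (by linarith) (by positivity)
      _ ≤ 1.44 * (1 + (2 * (5 * b + 1) + 1 / 4) + 1 / 4 + 1 / 8) :=
          mul_le_mul_of_nonneg_right hz2 (by positivity)
      _ ≤ 16 * b + 15 / 4 := by linarith
  have hwin := makerWins_of_goodLevels hn0 hb hgood howner (Real.log_nonneg hz1.le)
    (by rw [hz]; exact exp_log_mul_le hb) (fun e => le_level_div hn0 c e) (by linarith) hsum
  refine MakerCanBuild.mono ?_ hwin
  have h8 : (Y : ℝ) * a / n ≤ 1 / 4 := by
    rw [div_le_iff₀ hnpos]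
    have : 4 * (Y : ℝ) * a ≤ n := by exact_mod_cast hYn
    linarith
  linarith

open scoped Classical in
theorem measure_not_makerWins_le {n b a L Y : ℕ} (hb : 0 < b) (ha : 0 < a)
    (hn : 16 * (5 * b + 1) + 2 ≤ n) (hLa : 12 * L ^ 2 ≤ a) (hLY : L ≤ Y)
    (hY : 8 * (b + 1) * a ≤ Y) (hYn : 4 * Y * a ≤ n) {κ : ℝ}
    (hκ : κ = 1 / (5 * b + 1) * (n - 2) / (2 * n)) :
    (costLaw n).real {c | ¬ MakerWins b c (16 * b + 4)} ≤
      12 * (L : ℝ) ^ 2 / a + (1 / 2) ^ n + 4 * (L : ℝ) ^ 2 / n +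
        8 * (n : ℝ) ^ 2 * Real.exp (-(κ * L)) := by
  have hn0 : 0 < n := by omega
  have hn2 : 2 < n := by omega
  have hYn' : Y ≤ n := by nlinarith
  have hLn : L ≤ n := hLY.trans hYn'
  obtain ⟨owner, howner, hcard⟩ := exists_owner n
  have hdisj : ∀ u v, u ≠ v → Disjoint (Finset.univ.filter fun e => owner e = u)
      (Finset.univ.filter fun e => owner e = v) := by
    intro u v huv
    rw [Finset.disjoint_left]
    intro e he he'
    simp only [Finset.mem_filter, Finset.mem_univ, true_and] at he he'
    exact huv (he.symm.trans he')
  have hOc : ∀ v, ((n : ℝ) - 2) / 2 ≤ (Finset.univ.filter fun e => owner e = v).card := by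
    intro v
    have h1 : (n : ℝ) ≤ 2 * (Finset.univ.filter fun e => owner e = v).card + 2 := by
      have h := hcard v
      have h' : n ≤ 2 * (Finset.univ.filter fun e => owner e = v).card + 2 := by convert! h
      exact_mod_cast h'
    linarith
  obtain ⟨r, hr⟩ : ∃ r : ℝ, r = (1 + 1 / (5 * (b : ℝ)))⁻¹ := ⟨_, rfl⟩
  have hr0 : 0 ≤ r := by rw [hr]; positivity
  have h1r : 1 - r = 1 / (5 * b + 1) := by
    rw [hr]
    field_simp
    ring
  have hr1 : r < 1 := by
    have : 0 < 1 / (5 * (b : ℝ) + 1) := by positivity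
    linarith
  have hκ' : κ = (1 - r) * (n - 2) / (2 * n) := by rw [hκ, h1r]
  have hp1 := measure_not_sparse_le (n := n) (a := a) (L := L) hn0 ha hLn (by exact_mod_cast hLa)
  have hp2 := measure_not_expand_le (n := n) (a := a) (b := b) (Y := Y) hn0 hY hYn'
  have hp3 := measure_sum_pow_cheap_ge_le hdisj hn2 hOc hLn hr0 hr1 hκ'
  have hp4 := measure_pow_cheap_ge_le hn2 hOc hLn hr0 hr1 hκ'
  have hsub : {c | ¬ MakerWins b c (16 * b + 4)} ⊆
      {c | ∃ S : Finset (Fin n), S.card * a < n ∧ 2 * S.card <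
        (Finset.univ.filter fun e : Edge n =>
          (∀ x ∈ (e : Sym2 (Fin n)), x ∈ S) ∧ level c e ≤ L).card} ∪
      {c | ∃ S : Finset (Fin n), n ≤ S.card * a ∧ 2 * S.card ≤ n ∧
        (Finset.univ.filter fun e : Edge n => Crosses S e ∧ level c e ≤ Y).card ≤ b * n} ∪
      {c | n * (1 + 1 / κ) + n / 4 ≤ ∑ v, ∑ i ∈ Finset.range L,
        r ^ cheap (Finset.univ.filter fun e => owner e = v) ((i : ℝ) / n) c} ∪
      {c | 1 / 8 ≤ n * ∑ v,
        r ^ cheap (Finset.univ.filter fun e => owner e = v) ((L : ℝ) / n) c} := by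
    intro c hc
    by_contra hE
    simp only [Set.mem_union, not_or] at hE
    obtain ⟨⟨⟨h1, h2⟩, h3⟩, h4⟩ := hE
    rw [Set.mem_ofPred_eq, not_le] at h3 h4
    refine hc (makerWins_of_cheap_lt (a := a) (L := L) (Y := Y) hb hn hYn hκ hr howner
      ⟨hLY, fun S hS => ?_, fun S hS hS' => ?_⟩ (by convert! h3) (by convert! h4))
    · by_contra! h
      exact h1 ⟨S, hS, h⟩
    · by_contra! h
      exact h2 ⟨S, hS, hS', h⟩
  have hu := measureReal_mono hsub (measure_ne_top (costLaw n) _)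
  refine hu.trans ((measureReal_union_le _ _).trans (add_le_add ?_ hp4))
  refine (measureReal_union_le _ _).trans (add_le_add ?_ hp3)
  exact (measureReal_union_le _ _).trans (add_le_add hp1 hp2)

theorem tendsto_measure_not_makerWins {b : ℕ} (hb : 0 < b) :
    Tendsto (fun n => (costLaw n).real {c | ¬ MakerWins b c (16 * b + 4)}) atTop (𝓝 0) := by
  -- The choice is `L = m`, `a = m ^ 3` and `Y = 8 * (b + 1) * m ^ 3`: then `L ^ 2 / a = 1 / m`, and
  -- `4 * Y * a` is a constant times `m ^ 6`, so at most `m ^ 7 ≤ n` eventually.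
  set m : ℕ → ℕ := fun n => ⌊(n : ℝ) ^ (1 / 7 : ℝ)⌋₊ with hm
  have hmt : Tendsto m atTop atTop :=
    tendsto_nat_floor_atTop.comp
      ((tendsto_rpow_atTop (by norm_num)).comp tendsto_natCast_atTop_atTop)
  have hpow : ∀ n : ℕ, ((n : ℝ) ^ (1 / 7 : ℝ)) ^ 7 = n := by
    intro n
    rw [← Real.rpow_natCast, ← Real.rpow_mul (by positivity)]
    norm_num
  have hlow : ∀ n, m n ^ 7 ≤ n := by
    intro n
    have h1 : (m n : ℝ) ≤ (n : ℝ) ^ (1 / 7 : ℝ) := Nat.floor_le (by positivity)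
    have h2 := pow_le_pow_left₀ (by positivity) h1 7
    rw [hpow] at h2
    exact_mod_cast h2
  have hup : ∀ n, n ≤ (m n + 1) ^ 7 := by
    intro n
    have h1 : (n : ℝ) ^ (1 / 7 : ℝ) ≤ m n + 1 := (Nat.lt_floor_add_one _).le
    have h2 := pow_le_pow_left₀ (by positivity) h1 7
    rw [hpow] at h2
    exact_mod_cast h2
  -- A lower bound, free of `n`, for the actual rate, since `n - 2 ≥ n / 2` when `n ≥ 4`.
  set κ : ℝ := 1 / (4 * (5 * b + 1)) with hκ
  have hκ0 : 0 < κ := by positivity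
  set g : ℕ → ℝ := fun k => 12 / k + (1 / 2) ^ k + 4 / k +
    8 * 2 ^ 14 * ((k : ℝ) ^ 14 * Real.exp (-κ * k)) with hg
  have hgt : Tendsto g atTop (𝓝 0) := by
    have h1 := tendsto_const_div_atTop_nhds_zero_nat (12 : ℝ)
    have h2 := tendsto_pow_atTop_nhds_zero_of_lt_one (show (0 : ℝ) ≤ 1 / 2 by norm_num)
      (by norm_num)
    have h3 := tendsto_const_div_atTop_nhds_zero_nat (4 : ℝ)
    have h4 : Tendsto (fun k : ℕ => (k : ℝ) ^ 14 * Real.exp (-κ * k)) atTop (𝓝 0) := by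
      have h5 := (tendsto_rpow_mul_exp_neg_mul_atTop_nhds_zero 14 κ hκ0).comp
        tendsto_natCast_atTop_atTop
      refine h5.congr fun k => ?_
      simp only [Function.comp]
      norm_cast
    have := ((h1.add h2).add h3).add (h4.const_mul (8 * 2 ^ 14))
    simp only [add_zero, mul_zero] at this
    exact this
  refine squeeze_zero' (g := g ∘ m) (Eventually.of_forall fun n => measureReal_nonneg) ?_
    (hgt.comp hmt)
  filter_upwards [hmt.eventually_ge_atTop (32 * (5 * b + 1) + 4)] with n hn
  have hlo := hlow n
  have hhi := hup n
  simp only [Function.comp]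
  generalize m n = k at hn hlo hhi
  have hk : 1 ≤ k := by omega
  have hkn : k ≤ n := le_trans (by nlinarith [Nat.pow_le_pow_right hk (show 1 ≤ 7 by norm_num)]) hlo
  have hkR : (1 : ℝ) ≤ k := by exact_mod_cast hk
  have hnR : (4 : ℝ) ≤ n := by exact_mod_cast (show 4 ≤ n by omega)
  have hb' : (1 : ℝ) ≤ b := by exact_mod_cast hb
  have h := measure_not_makerWins_le (n := n) (b := b) (a := k ^ 3) (L := k)
    (Y := 8 * (b + 1) * k ^ 3) (κ := 1 / (5 * b + 1) * (n - 2) / (2 * n)) hb (by positivity)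
    (by omega) ?_ ?_ le_rfl ?_ rfl
  rotate_left
  · rw [pow_succ k 2, mul_comm]
    exact Nat.mul_le_mul_left _ (by omega)
  · have : k ≤ k ^ 3 := Nat.le_self_pow (by norm_num) k
    nlinarith
  · refine le_trans ?_ hlo
    have h1 : 32 * (b + 1) ≤ k := by omega
    calc 4 * (8 * (b + 1) * k ^ 3) * k ^ 3 = 32 * (b + 1) * k ^ 6 := by ring
      _ ≤ k * k ^ 6 := Nat.mul_le_mul_right _ h1
      _ = k ^ 7 := by ring
  refine h.trans ?_
  simp only [hg]
  have h1 : 12 * (k : ℝ) ^ 2 / ((k ^ 3 : ℕ) : ℝ) = 12 / k := by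
    push_cast
    field_simp
  have h2 : (1 / 2 : ℝ) ^ n ≤ (1 / 2) ^ k := pow_le_pow_of_le_one (by norm_num) (by norm_num) hkn
  have h3 : 4 * (k : ℝ) ^ 2 / n ≤ 4 / k := by
    rw [div_le_div_iff₀ (by linarith) (by linarith)]
    have h4 : (k : ℝ) ^ 3 ≤ n := by
      exact_mod_cast (Nat.pow_le_pow_right hk (show 3 ≤ 7 by norm_num)).trans hlo
    nlinarith
  have h4 : 8 * (n : ℝ) ^ 2 * Real.exp (-(1 / (5 * b + 1) * (n - 2) / (2 * n) * k)) ≤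
      8 * 2 ^ 14 * ((k : ℝ) ^ 14 * Real.exp (-κ * k)) := by
    have h5 : (n : ℝ) ≤ (2 * k) ^ 7 := by
      have h6 : (n : ℝ) ≤ (k + 1) ^ 7 := by exact_mod_cast hhi
      exact h6.trans (pow_le_pow_left₀ (by positivity) (by linarith) 7)
    have h6 : (n : ℝ) ^ 2 ≤ 2 ^ 14 * (k : ℝ) ^ 14 := by
      refine (pow_le_pow_left₀ (by positivity) h5 2).trans (le_of_eq ?_)
      ring
    have h7 : κ ≤ 1 / (5 * b + 1) * (n - 2) / (2 * n) := by
      rw [hκ, le_div_iff₀ (by positivity), one_div_mul_eq_div, one_div_mul_eq_div,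
        div_le_div_iff₀ (by positivity) (by positivity)]
      nlinarith
    have h8 : Real.exp (-(1 / (5 * b + 1) * (n - 2) / (2 * n) * k)) ≤ Real.exp (-κ * k) := by
      rw [Real.exp_le_exp, neg_mul, neg_le_neg_iff]
      exact mul_le_mul_of_nonneg_right h7 (by linarith)
    calc _ ≤ 8 * (2 ^ 14 * (k : ℝ) ^ 14) * Real.exp (-κ * k) := by gcongr
      _ = _ := by ring
  linarith

end Main

theorem theorem4 (b : ℕ) (hb : 1 ≤ b) :
    ∃ ε : ℕ → ℝ, Tendsto ε atTop (𝓝 0) ∧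
      Tendsto
        (fun n : ℕ => costLaw n
          {c : Edge n → ℝ | MakerWins b c (4 * muB b * ((b : ℝ) / thetaStar + b + 1 + ε n))})
        atTop (𝓝 1) := by
  refine ⟨fun _ => 0, tendsto_const_nhds, ?_⟩
  rw [← ENNReal.tendsto_toReal_iff (fun n => measure_ne_top _ _) ENNReal.one_ne_top]
  have h := (tendsto_measure_not_makerWins hb).const_sub 1
  rw [sub_zero] at h
  refine tendsto_of_tendsto_of_tendsto_of_le_of_le h tendsto_const_nhds (fun n => ?_)
    fun n => measureReal_le_one
  have h1 : {c : Edge n → ℝ | MakerWins b c (16 * b + 4)} ⊆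
      {c | MakerWins b c (4 * muB b * ((b : ℝ) / thetaStar + b + 1 + 0))} :=
    fun c hc => MakerCanBuild.mono (sixteen_mul_add_four_le b) hc
  have h2 := measureReal_mono h1 (measure_ne_top (costLaw n) _)
  -- Subadditivity is enough here, so measurability of the winning event plays no role.
  have h3 := measureReal_union_le (μ := costLaw n) {c | MakerWins b c (16 * b + 4)}
    {c | ¬ MakerWins b c (16 * b + 4)}
  have h4 : {c : Edge n → ℝ | MakerWins b c (16 * b + 4)} ∪
      {c | ¬ MakerWins b c (16 * b + 4)} = Set.univ := Set.union_compl_self _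
  rw [h4, probReal_univ] at h3
  change 1 - _ ≤ (costLaw n).real _
  simp only at h2 ⊢
  linarith
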